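/- **Theorem (comparison of the analytic functional calculi of the periodic algebra and of the torus algebra).** *Setting.* Let $d,\mathcal N\ge 1$ be integers, $W\in\mathbb R$, and let $\mathbf F$ be a real antisymmetric $d\times d$ matrix whose entries lie in $\frac{2}{2\mathcal N+1}\mathbb Z$. Write $\mathbf x\cdot\mathbf F\cdot\mathbf y=\sum_{j,k}x_jF_{jk}y_k$, let $|\mathbf n|$ be the Euclidean norm on $\mathbb Z^d$, let $\Omega=[-\frac12,\frac12]^{\mathbb Z^d}$ with translations $(\mathfrak t_{\mathbf m}\omega)_{\mathbf n}=\omega_{\mathbf n+\mathbf m}$, and let $\Omega_{\rm per}\subset\Omega$ be the set of configurations of period $2\mathcal N+1$ in each coordinate direction. The periodic algebra $\mathcal A_{\rm per}=C^*(\Omega_{\rm per}\times\mathbb Z^d,\mathbf F)$ is the completion of the compactly supported continuous functions $f:\Omega_{\rm per}\times\mathbb Z^d\to\mathbb C$, with the operations $$(f*g)(\omega,\mathbf n)=\sum_{\mathbf m}f(\omega,\mathbf m)\,g(\mathfrak t_{\mathbf m}^{-1}\omega,\mathbf n-\mathbf m)\,e^{i\pi\,\mathbf n\cdot\mathbf F\cdot\mathbf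 m},\qquad f^*(\omega,\mathbf n)=\overline{f(\mathfrak t_{\mathbf n}^{-1}\omega,-\mathbf n)},$$ in the norm $\|f\|=\sup_\omega\|\pi_\omega f\|$, where $\pi_\omega f$ acts on $\ell^2(\mathbb Z^d)$ by $$((\pi_\omega f)\phi)(\mathbf n)=\sum_{\mathbf m}f(\mathfrak t_{\mathbf n}^{-1}\omega,\mathbf m-\mathbf n)\,e^{i\pi\,\mathbf m\cdot\mathbf F\cdot\mathbf n}\phi(\mathbf m).$$ An element $f$ of the completion is identified with the function $f(\omega,\mathbf n)=\langle\mathbf 0|\pi_\omega f|\mathbf n\rangle$. The torus algebra $\mathcal A_{\mathbb T}=C^*(\Omega_{\mathcal N}\times\mathbb T_d,\mathbf F)$ consists of the continuous functions on $\Omega_{\mathcal N}\times\mathbb T_d$, where $\mathbb T_d=(\mathbb Z/(2\mathcal N+1))^d$ and $\Omega_{\mathcal N}=[-\frac12,\frac12]^{\mathbb T_d}$. Its operations and norm are given by the same formulas, with $\mathbb T_d$ acting by rotations and with the phases computed from the coordinates $\mathbf n_{\mathbf p}\in\{-\mathcal N,\dots,\mathcal N\}^d$ of $\mathbf p\in\mathbb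 T_d$. Identify $\Omega_{\rm per}$ with $\Omega_{\mathcal N}$ by restriction to one cell, and define $$P:\mathcal A_{\rm per}\to\mathcal A_{\mathbb T},\quad(Pf)(\omega,\mathbf p)=f(\omega,\mathbf n_{\mathbf p}),\qquad J:\mathcal A_{\mathbb T}\to\mathcal A_{\rm per},\quad(J\tilde f)(\omega,\mathbf n)=\sum_{\mathbf q\in\mathbb T_d}\delta_{\mathbf n,\mathbf n_{\mathbf q}}\tilde f(\omega,\mathbf q).$$ Let $h(\omega,\mathbf n)=\delta_{|\mathbf n|,1}+W\omega_{\mathbf n}\delta_{\mathbf n,\mathbf 0}$ be the nearest-neighbour Hamiltonian and $\tilde h=P(h|_{\Omega_{\rm per}\times\mathbb Z^d})\in\mathcal A_{\mathbb T}$. The spectra $\sigma(\tilde h)$ and $\sigma(J\tilde h)$ are taken in $\mathcal A_{\mathbb T}$ and in $\mathcal A_{\rm per}$. Put $A_k(\xi)=\sum_{\gamma\in\mathbb Z^k}e^{-\xi|\gamma|}$. *Conclusion.* (i) For every $z\notin\sigma(J\tilde h)$ one has $z\notin\sigma(\tilde h)$, and whenever $0<\xi<\sinh^{-1}\!\big(\mathrm{dist}(z,\sigma(J\tilde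 h))/2d\big)$, $$\big\|(\tilde h-z\mathbf 1)^{-1}-P(J\tilde h-z\mathbf 1)^{-1}\big\|\le\frac{4d^2A_{d-1}(\xi/\sqrt2)\,e^{-\xi\mathcal N/\sqrt2}}{\mathrm{dist}(z,\sigma(\tilde h))\,\big(\mathrm{dist}(z,\sigma(J\tilde h))-2d\sinh\xi\big)}.$$ (ii) Let $\kappa>0$, let $\Phi$ be analytic on (a neighbourhood of) $\{z:\mathrm{dist}(z,\sigma(J\tilde h))\le\kappa\}$, and let $\mathcal C_\kappa$ be the contour $\{z:\mathrm{dist}(z,\sigma(J\tilde h))=\kappa\}$, counterclockwise. Put $\bar\Phi=\frac1{2\pi}\int_{\mathcal C_\kappa}|\Phi(z)|\,|dz|$ and, for $a=\tilde h$ and $a=J\tilde h$, $$\Phi(a)=\frac{i}{2\pi}\oint_{\mathcal C_\kappa}\Phi(z)(a-z\mathbf 1)^{-1}dz .$$ These integrals, and the contour integral of $\Phi$, converge absolutely, and whenever $0<\xi<\sinh^{-1}(\kappa/2d)$, $$\|\Phi(\tilde h)-P\,\Phi(J\tilde h)\|\le\frac{4d^2A_{d-1}(\xi/\sqrt2)\,\bar\Phi\,e^{-\xi\mathcal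 N/\sqrt2}}{\kappa(\kappa-2d\sinh\xi)} .$$ -/

import Mathlib

open scoped ENNReal

noncomputable section

namespace NCTorus

/-! ### Twisted crossed products

Both `C*(Ω_per × ℤ^d, F)` and `C*(Ω_N × 𝕋_d, F)` are built by the same recipe, from a commutative
group `G` (`ℤ^d`, respectively the discrete torus) acting on a compact space `Ω` of disorder
configurations and from the magnetic phase `e^{iπ n·F·m}`. The recipe is written once. -/

/-- An action `𝔱` of the commutative group `G` on the space `Ω` by continuous maps, together with
a magnetic phase `phase n m`, which is `e^{iπ n·F·m}` in both uses below. -/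
structure MagneticSystem (G Ω : Type) [AddCommGroup G] [TopologicalSpace Ω] where
  shift : G → Ω → Ω
  continuous_shift : ∀ n, Continuous (shift n)
  shift_zero : ∀ ω, shift 0 ω = ω
  shift_add : ∀ m n ω, shift (m + n) ω = shift m (shift n ω)
  phase : G → G → ℂ
  norm_phase : ∀ n m, ‖phase n m‖ = 1
  phase_self : ∀ n, phase n n = 1
  phase_add_left : ∀ n n' m, phase (n + n') m = phase n m * phase n' m
  phase_add_right : ∀ n m m', phase n (m + m') = phase n m * phase n m'

/-- The Hilbert space `ℓ²(G)`. -/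
abbrev L2 (G : Type) : Type := lp (fun _ : G => ℂ) 2

/-- The bounded operators on `ℓ²(G)`, with the operator norm. -/
abbrev Op (G : Type) : Type := L2 G →L[ℂ] L2 G

/-- The vector `|n⟩` of the standard basis of `ℓ²(G)`. -/
def ket {G : Type} (n : G) : L2 G := by
  classical exact lp.single 2 n 1

theorem ket_apply {G : Type} [DecidableEq G] (m n : G) :
    (ket m : L2 G) n = if n = m then 1 else 0 := by
  unfold ket
  by_cases h : n = m
  · subst h
    rw [if_pos rfl]
    exact @lp.single_apply_self _ _ _ (fun a b => Classical.propDecidable (a = b)) _ _ _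
  · rw [if_neg h]
    exact @lp.single_apply_ne _ _ _ (fun a b => Classical.propDecidable (a = b)) _ _ _ _ h

theorem norm_ket {G : Type} (n : G) : ‖(ket n : L2 G)‖ = 1 := by
  classical
  have h := lp.norm_single (E := fun _ : G => ℂ) (p := 2) (by norm_num) n 1
  rw [norm_one] at h
  exact h

instance instNontrivialL2 {G : Type} [AddCommGroup G] : Nontrivial (L2 G) := by
  classical
  refine ⟨⟨ket 0, 0, fun h => ?_⟩⟩
  have := congrArg (fun v : L2 G => v 0) h
  simp [ket_apply] at this

/-- Continuous functions `f(ω, n)` on `Ω × G` with compact support: finitely many `n` occur. -/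
abbrev Kern (G Ω : Type) [TopologicalSpace Ω] : Type := G →₀ C(Ω, ℂ)

/-- Bounded families of bounded operators indexed by `Ω`, with the norm `sup_ω ‖A_ω‖` and the
operations taken at each `ω`. -/
abbrev Fam (G Ω : Type) : Type := lp (fun _ : Ω => Op G) ∞

/-! Names for the instances which Mathlib provides on `Fam G Ω`, to guide instance search. -/

section FamInstances

variable {G Ω : Type} [AddCommGroup G]

instance instNormOneClassOp : NormOneClass (Op G) := inferInstance

instance instNormedRingFam : NormedRing (Fam G Ω) := lp.inftyNormedRing

instance instNormedAlgebraFam : NormedAlgebra ℂ (Fam G Ω) := lp.inftyNormedAlgebra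

instance instStarRingFam : StarRing (Fam G Ω) := inferInstance

instance instCStarRingFam : CStarRing (Fam G Ω) := inferInstance

instance instStarModuleFam : StarModule ℂ (Fam G Ω) := inferInstance

instance instTopologicalRingFam : IsTopologicalRing (Fam G Ω) := inferInstance

instance instContinuousStarFam : ContinuousStar (Fam G Ω) := inferInstance

instance instCompleteSpaceFam : CompleteSpace (Fam G Ω) := inferInstance

instance instCStarAlgebraFam : CStarAlgebra (Fam G Ω) where

end FamInstances

theorem hop_memlp {G : Type} [AddCommGroup G] (k : G) (a : G → ℂ) (C : ℝ)
    (ha : ∀ n, ‖a n‖ ≤ C) (φ : L2 G) : Memℓp (fun n => a n * φ (n + k)) 2 := by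
  have h2 : (0 : ℝ) < (2 : ℝ≥0∞).toReal := by norm_num
  have hs : Summable fun n => ‖φ (n + k)‖ ^ (2 : ℝ≥0∞).toReal :=
    ((lp.memℓp φ).summable h2).comp_injective (add_left_injective k)
  refine memℓp_gen (Summable.of_nonneg_of_le (fun n => by positivity) (fun n => ?_)
    (hs.mul_left (C ^ (2 : ℝ≥0∞).toReal)))
  rw [norm_mul, Real.mul_rpow (norm_nonneg _) (norm_nonneg _)]
  gcongr
  exact ha n

/-- The operator `φ ↦ (n ↦ a(n) φ(n + k))`, for a bounded function `a`. -/
def hop {G : Type} [AddCommGroup G] (k : G) (a : G → ℂ) (C : ℝ)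
    (ha : ∀ n, ‖a n‖ ≤ C) : Op G :=
  LinearMap.mkContinuous
    { toFun := fun φ => ⟨fun n => a n * φ (n + k), hop_memlp k a C ha φ⟩
      map_add' := fun φ ψ => by
        ext n
        exact mul_add _ _ _
      map_smul' := fun c φ => by
        ext n
        exact mul_left_comm _ _ _ } C (fun φ => by
    have hC : 0 ≤ C := (norm_nonneg _).trans (ha 0)
    have h2 : (0 : ℝ) < (2 : ℝ≥0∞).toReal := by norm_num
    have hs : Summable fun n => ‖φ n‖ ^ (2 : ℝ≥0∞).toReal := (lp.memℓp φ).summable h2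
    have hs' : Summable fun n => ‖φ (n + k)‖ ^ (2 : ℝ≥0∞).toReal :=
      hs.comp_injective (add_left_injective k)
    refine lp.norm_le_of_tsum_le h2 (by positivity) ?_
    rw [Real.mul_rpow hC (norm_nonneg _), lp.norm_rpow_eq_tsum h2]
    have e : ∑' n, ‖φ (n + k)‖ ^ (2 : ℝ≥0∞).toReal = ∑' n, ‖φ n‖ ^ (2 : ℝ≥0∞).toReal :=
      (Equiv.addRight k).tsum_eq (fun n => ‖φ n‖ ^ (2 : ℝ≥0∞).toReal)
    rw [← e, ← tsum_mul_left]
    refine Summable.tsum_le_tsum (fun n => ?_)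
      ((lp.memℓp (⟨_, hop_memlp k a C ha φ⟩ : L2 G)).summable h2) (hs'.mul_left _)
    change ‖a n * φ (n + k)‖ ^ _ ≤ _
    rw [norm_mul, Real.mul_rpow (norm_nonneg _) (norm_nonneg _)]
    gcongr
    exact ha n)

theorem hop_apply {G : Type} [AddCommGroup G] (k : G) (a : G → ℂ) (C : ℝ)
    (ha : ∀ n, ‖a n‖ ≤ C) (φ : L2 G) (n : G) : hop k a C ha φ n = a n * φ (n + k) := rfl

theorem norm_hop_le {G : Type} [AddCommGroup G] (k : G) (a : G → ℂ) (C : ℝ)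
    (ha : ∀ n, ‖a n‖ ≤ C) : ‖hop k a C ha‖ ≤ C :=
  LinearMap.mkContinuous_norm_le _ ((norm_nonneg _).trans (ha 0)) _

theorem op_ext {G : Type} {A B : Op G} (h : ∀ m n, A (ket m) n = B (ket m) n) : A = B := by
  classical
  ext1 φ
  have hs := lp.hasSum_single (p := 2) (by norm_num) φ
  have key : ∀ m, A (lp.single 2 m (φ m)) = B (lp.single 2 m (φ m)) := by
    intro m
    have e : lp.single 2 m (φ m) = φ m • (ket m : L2 G) := by
      ext n
      simp only [lp.coeFn_smul, Pi.smul_apply, ket_apply, smul_eq_mul, lp.single_apply]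
      by_cases hn : n = m
      · subst hn; simp
      · simp [hn]
    rw [e, map_smul, map_smul]
    congr 1
    ext n
    exact h m n
  have hA := A.hasSum hs
  have hB := B.hasSum hs
  simp only [key] at hA
  exact hA.unique hB

theorem inner_ket {G : Type} (n : G) (φ : L2 G) : inner ℂ (ket n) φ = φ n := by
  classical
  rw [lp.inner_eq_tsum, tsum_eq_single n]
  · simp [ket_apply]
  · intro m hm
    simp [ket_apply, hm]

section System

variable {G Ω : Type} [AddCommGroup G] [TopologicalSpace Ω]

namespace MagneticSystem

theorem phase_zero_left (S : MagneticSystem G Ω) (m : G) : S.phase 0 m = 1 := by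
  have h := S.phase_add_left 0 0 m
  have h0 : S.phase 0 m ≠ 0 := by
    intro h0
    have := S.norm_phase 0 m
    simp [h0] at this
  rw [add_zero] at h
  exact (mul_right_cancel₀ h0 (by rw [one_mul]; exact h)).symm

theorem phase_zero_right (S : MagneticSystem G Ω) (m : G) : S.phase m 0 = 1 := by
  have h := S.phase_add_right m 0 0
  have h0 : S.phase m 0 ≠ 0 := by
    intro h0
    have := S.norm_phase m 0
    simp [h0] at this
  rw [add_zero] at h
  exact (mul_right_cancel₀ h0 (by rw [one_mul]; exact h)).symm

theorem phase_mul_swap (S : MagneticSystem G Ω) (n m : G) : S.phase n m * S.phase m n = 1 := by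
  have h := S.phase_self (n + m)
  rw [S.phase_add_left, S.phase_add_right, S.phase_add_right, S.phase_self, S.phase_self] at h
  simpa using h

theorem conj_phase (S : MagneticSystem G Ω) (n m : G) :
    (starRingEnd ℂ) (S.phase n m) = S.phase m n := by
  have h0 : S.phase n m ≠ 0 := by
    intro h0
    have := S.norm_phase n m
    simp [h0] at this
  apply mul_left_cancel₀ h0
  rw [S.phase_mul_swap, Complex.mul_conj, Complex.normSq_eq_norm_sq, S.norm_phase]
  simp

/-- The multiplication `(f * g)(ω, n) = ∑_m f(ω, m) g(𝔱_m⁻¹ω, n - m) e^{iπ n·F·m}`. -/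
def conv (S : MagneticSystem G Ω) (f g : Kern G Ω) : Kern G Ω := by
  classical
  exact Finsupp.onFinset (f.support.biUnion fun m => g.support.image fun k => m + k)
    (fun n => ∑ m ∈ f.support, f m * (g (n - m)).comp ⟨S.shift (-m), S.continuous_shift (-m)⟩
      * ContinuousMap.const Ω (S.phase n m))
    (by
      intro n hn
      obtain ⟨m, hm, h⟩ := Finset.exists_ne_zero_of_sum_ne_zero hn
      have hg : g (n - m) ≠ 0 := by
        intro h0
        apply h
        rw [h0]
        ext ω
        simp
      exact Finset.mem_biUnion.2 ⟨m, hm, Finset.mem_image.2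
        ⟨n - m, Finsupp.mem_support_iff.2 hg, by abel⟩⟩)

theorem conv_apply (S : MagneticSystem G Ω) (f g : Kern G Ω) (n : G) (ω : Ω) :
    S.conv f g n ω
      = ∑ m ∈ f.support, f m ω * g (n - m) (S.shift (-m) ω) * S.phase n m := by
  simp [conv, ContinuousMap.sum_apply]

/-- The `*`-operation, the complex conjugate of `f(𝔱_n⁻¹ω, -n)`. -/
def adj (S : MagneticSystem G Ω) (f : Kern G Ω) : Kern G Ω := by
  classical
  exact Finsupp.onFinset (f.support.image fun k => -k)
    (fun n => star ((f (-n)).comp ⟨S.shift (-n), S.continuous_shift (-n)⟩))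
    (by
      intro n hn
      have hf : f (-n) ≠ 0 := by
        intro h0
        apply hn
        rw [h0]
        ext ω
        simp
      exact Finset.mem_image.2 ⟨-n, Finsupp.mem_support_iff.2 hf, neg_neg n⟩)

theorem adj_apply (S : MagneticSystem G Ω) (f : Kern G Ω) (n : G) (ω : Ω) :
    S.adj f n ω = (starRingEnd ℂ) (f (-n) (S.shift (-n) ω)) := rfl

variable [CompactSpace Ω]

theorem norm_coeff_le (S : MagneticSystem G Ω) (f : Kern G Ω) (ω : Ω) (k n : G) :
    ‖f k (S.shift (-n) ω) * S.phase (n + k) n‖ ≤ ‖f k‖ := by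
  rw [norm_mul, S.norm_phase, mul_one]
  exact (f k).norm_coe_le_norm _

/-- The representation
`((π_ω f)φ)(n) = ∑_m f(𝔱_n⁻¹ω, m - n) e^{iπ m·F·n} φ(m)`; the sum is written over `k = m - n`. -/
def rep (S : MagneticSystem G Ω) (f : Kern G Ω) (ω : Ω) : Op G :=
  ∑ k ∈ f.support, hop k (fun n => f k (S.shift (-n) ω) * S.phase (n + k) n) ‖f k‖
    (S.norm_coeff_le f ω k)

theorem rep_apply_of_subset (S : MagneticSystem G Ω) (f : Kern G Ω) (ω : Ω) (φ : L2 G) (n : G)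
    (s : Finset G) (hs : f.support ⊆ s) :
    S.rep f ω φ n = ∑ k ∈ s, f k (S.shift (-n) ω) * S.phase (n + k) n * φ (n + k) := by
  have h1 : S.rep f ω φ n
      = ∑ k ∈ f.support, f k (S.shift (-n) ω) * S.phase (n + k) n * φ (n + k) := by
    rw [rep, sum_apply, lp.coeFn_sum, Finset.sum_apply]
    rfl
  rw [h1]
  refine Finset.sum_subset hs fun k _ hk => ?_
  rw [Finsupp.notMem_support_iff] at hk
  simp [hk]

theorem norm_rep_le (S : MagneticSystem G Ω) (f : Kern G Ω) (ω : Ω) :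
    ‖S.rep f ω‖ ≤ ∑ k ∈ f.support, ‖f k‖ :=
  (norm_sum_le _ _).trans (Finset.sum_le_sum fun _ _ => norm_hop_le _ _ _ _)

theorem rep_ket (S : MagneticSystem G Ω) (f : Kern G Ω) (ω : Ω) (m n : G) :
    S.rep f ω (ket m) n = f (m - n) (S.shift (-n) ω) * S.phase m n := by
  classical
  rw [S.rep_apply_of_subset f ω _ n (insert (m - n) f.support) (Finset.subset_insert _ _),
    Finset.sum_eq_single (m - n)]
  · simp [ket_apply]
  · intro k _ hk
    have : n + k ≠ m := fun h => hk (by rw [← h]; abel)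
    simp [ket_apply, this]
  · intro h
    exact absurd (Finset.mem_insert_self _ _) h

theorem rep_conv (S : MagneticSystem G Ω) (f g : Kern G Ω) (ω : Ω) :
    S.rep (S.conv f g) ω = S.rep f ω * S.rep g ω := by
  classical
  ext φ n
  set U : Finset G := f.support.biUnion fun m => g.support.image fun k => m + k with hU
  have hsub : (S.conv f g).support ⊆ U := by
    unfold conv
    exact Finsupp.support_onFinset_subset
  rw [S.rep_apply_of_subset _ ω φ n U hsub]
  change _ = S.rep f ω (S.rep g ω φ) n
  rw [S.rep_apply_of_subset f ω _ n f.support subset_rfl]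
  simp_rw [S.conv_apply, Finset.sum_mul]
  rw [Finset.sum_comm]
  refine Finset.sum_congr rfl fun k hk => ?_
  rw [S.rep_apply_of_subset g ω φ (n + k) g.support subset_rfl, Finset.mul_sum]
  have himg : g.support.image (fun l => k + l) ⊆ U := fun j hj =>
    Finset.mem_biUnion.2 ⟨k, hk, hj⟩
  rw [← Finset.sum_subset himg]
  · rw [Finset.sum_image (fun a _ b _ h => add_left_cancel h)]
    refine Finset.sum_congr rfl fun l _ => ?_
    have e1 : S.shift (-k) (S.shift (-n) ω) = S.shift (-(n + k)) ω := by
      rw [← S.shift_add]; congr 1; abel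
    have e2 : k + l - k = l := by abel
    have e3 : n + (k + l) = n + k + l := by abel
    rw [e1, e2, e3]
    have p1 : S.phase (k + l) k * S.phase (n + k + l) n
        = S.phase (n + k) n * S.phase (n + k + l) (n + k) := by
      simp only [S.phase_add_left, S.phase_add_right, S.phase_self]
      linear_combination (-(S.phase l k * S.phase k n * S.phase l n)) * S.phase_mul_swap n k
    linear_combination (f k (S.shift (-n) ω) * g l (S.shift (-(n + k)) ω) * φ (n + k + l)) * p1
  · intro j _ hj
    have : g (j - k) = 0 := by
      by_contra h
      exact hj (Finset.mem_image.2 ⟨j - k, Finsupp.mem_support_iff.2 h, by abel⟩)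
    simp [this]

theorem rep_adj (S : MagneticSystem G Ω) (f : Kern G Ω) (ω : Ω) :
    S.rep (S.adj f) ω = star (S.rep f ω) := by
  refine op_ext fun m n => ?_
  have e : (star (S.rep f ω) (ket m)) n = (starRingEnd ℂ) (S.rep f ω (ket n) m) := by
    rw [← inner_ket n, ← inner_ket m, ContinuousLinearMap.star_eq_adjoint,
      ContinuousLinearMap.adjoint_inner_right, inner_conj_symm]
  have e1 : S.shift (-(m - n)) (S.shift (-n) ω) = S.shift (-m) ω := by
    rw [← S.shift_add]; congr 1; abel
  rw [e, S.rep_ket, S.rep_ket, S.adj_apply, e1, map_mul, S.conj_phase, neg_sub]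

/-- The family `(π_ω f)_ω`, in the algebra of bounded families of bounded operators. The norm of
this algebra is `sup_ω ‖·‖`, and its operations are taken at each `ω`. -/
def family (S : MagneticSystem G Ω) (f : Kern G Ω) : Fam G Ω :=
  ⟨fun ω => S.rep f ω, memℓp_infty ⟨∑ k ∈ f.support, ‖f k‖, by
    rintro _ ⟨ω, rfl⟩
    exact S.norm_rep_le f ω⟩⟩

theorem family_apply (S : MagneticSystem G Ω) (f : Kern G Ω) (ω : Ω) :
    S.family f ω = S.rep f ω := rfl

theorem family_add (S : MagneticSystem G Ω) (f g : Kern G Ω) :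
    S.family (f + g) = S.family f + S.family g := by
  refine lp.ext (funext fun ω => op_ext fun m n => ?_)
  change S.rep (f + g) ω (ket m) n = S.rep f ω (ket m) n + S.rep g ω (ket m) n
  simp only [S.rep_ket, Finsupp.add_apply, ContinuousMap.add_apply, add_mul]

theorem family_conv (S : MagneticSystem G Ω) (f g : Kern G Ω) :
    S.family (S.conv f g) = S.family f * S.family g :=
  lp.ext (funext fun ω => S.rep_conv f g ω)

theorem family_adj (S : MagneticSystem G Ω) (f : Kern G Ω) :
    S.family (S.adj f) = star (S.family f) :=
  lp.ext (funext fun ω => S.rep_adj f ω)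

theorem family_scalar (S : MagneticSystem G Ω) (c : ℂ) :
    S.family (Finsupp.single 0 (ContinuousMap.const Ω c))
      = algebraMap ℂ (Fam G Ω) c := by
  classical
  refine lp.ext (funext fun ω => op_ext fun m n => ?_)
  change S.rep (Finsupp.single 0 (ContinuousMap.const Ω c)) ω (ket m) n
    = (algebraMap ℂ (Op G) c) (ket m) n
  have e : (algebraMap ℂ (Op G) c) (ket m) n = c * (ket m : L2 G) n := by
    rw [Algebra.algebraMap_eq_smul_one]
    simp
  rw [e, S.rep_ket, ket_apply, Finsupp.single_apply]
  by_cases h : n = m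
  · subst h; simp [S.phase_self]
  · have : (0 : G) ≠ m - n := fun h0 => h (sub_eq_zero.1 h0.symm).symm
    simp [h, this]

/-- The `*`-algebra of the compactly supported functions `f(ω, n)`, in the faithful representation
`f ↦ (π_ω f)_ω`: its product is the multiplication `conv`, its involution is `adj`. -/
def core (S : MagneticSystem G Ω) : StarSubalgebra ℂ (Fam G Ω) where
  carrier := Set.range S.family
  mul_mem' := by
    rintro _ _ ⟨f, rfl⟩ ⟨g, rfl⟩
    exact ⟨S.conv f g, S.family_conv f g⟩
  add_mem' := by
    rintro _ _ ⟨f, rfl⟩ ⟨g, rfl⟩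
    exact ⟨f + g, S.family_add f g⟩
  algebraMap_mem' := fun c => ⟨_, S.family_scalar c⟩
  star_mem' := by
    rintro _ ⟨f, rfl⟩
    exact ⟨S.adj f, S.family_adj f⟩

/-- The C*-algebra: the completion of the compactly supported functions in the norm
`‖f‖ = sup_ω ‖π_ω f‖`, as a norm closure. (For a finite group `G` this adds nothing.) -/
abbrev Alg (S : MagneticSystem G Ω) : Type := S.core.topologicalClosure

instance instCStarAlgebraAlg (S : MagneticSystem G Ω) : CStarAlgebra S.Alg :=
  haveI := S.core.isClosed_topologicalClosure
  StarSubalgebra.cstarAlgebra S.core.topologicalClosure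

/-- A compactly supported function as an element of the C*-algebra. -/
def ofKern (S : MagneticSystem G Ω) (f : Kern G Ω) : S.Alg :=
  ⟨S.family f, S.core.le_topologicalClosure ⟨f, rfl⟩⟩

theorem continuous_kernel (S : MagneticSystem G Ω) (a : S.Alg) (n : G) :
    Continuous fun ω => (a : Fam G Ω) ω (ket n) 0 := by
  have ha : (a : Fam G Ω) ∈ closure (Set.range S.family) := a.2
  refine continuous_of_uniform_approx_of_continuous fun u hu => ?_
  obtain ⟨ε, hε, hεu⟩ := Metric.mem_uniformity_dist.1 hu
  obtain ⟨_, ⟨f, rfl⟩, hf⟩ := Metric.mem_closure_iff.1 ha ε hε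
  refine ⟨fun ω => S.rep f ω (ket n) 0, ?_, fun ω => hεu ?_⟩
  · simp only [S.rep_ket]
    exact ((f (n - 0)).continuous.comp (S.continuous_shift (-0))).mul continuous_const
  · have hk : ‖(ket n : L2 G)‖ = 1 := norm_ket n
    rw [dist_eq_norm] at hf ⊢
    refine lt_of_le_of_lt ?_ hf
    have h1 := lp.norm_apply_le_norm (p := ∞) ENNReal.top_ne_zero
      ((a : Fam G Ω) - S.family f) ω
    have h2 := ((((a : Fam G Ω) - S.family f) ω).le_opNorm (ket n))
    have h3 := lp.norm_apply_le_norm (p := 2) (by norm_num)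
      ((((a : Fam G Ω) - S.family f) ω) (ket n)) 0
    rw [hk, mul_one] at h2
    exact (h3.trans h2).trans h1

/-- The function `f(ω, n)` which an element of the C*-algebra is: `f(ω, n) = ⟨0|π_ω f|n⟩`. -/
def kernel (S : MagneticSystem G Ω) (a : S.Alg) (n : G) : C(Ω, ℂ) :=
  ⟨fun ω => (a : Fam G Ω) ω (ket n) 0, S.continuous_kernel a n⟩

theorem kernel_ofKern (S : MagneticSystem G Ω) (f : Kern G Ω) (n : G) :
    S.kernel (S.ofKern f) n = f n := by
  ext ω
  change S.rep f ω (ket n) 0 = _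
  rw [S.rep_ket, S.phase_zero_right]
  simp [S.shift_zero]

end MagneticSystem

end System

/-! ### Resolvents and the analytic functional calculus -/

/-- The resolvent `(a - z 1)⁻¹`. -/
def res {A : Type} [Ring A] [Algebra ℂ A] (a : A) (z : ℂ) : A :=
  Ring.inverse (a - algebraMap ℂ A z)

/-! For a compact set `K` of real numbers, the contour `𝒞_κ = {z | dist(z, K) = κ}` consists of the
points `x ± i √(κ² - dist(x, K)²)`, where `x` is real with `dist(x, K) ≤ κ`. It is traversed
counterclockwise: the lower half from left to right, the upper half from right to left. -/

/-- The real `x` over which the contour `𝒞_κ` lies (up to end points). -/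
def contourBase (K : Set ℂ) (κ : ℝ) : Set ℝ := {x | Metric.infDist (x : ℂ) K < κ}

/-- The point of the upper half of `𝒞_κ` over `x`. -/
def contourUpper (K : Set ℂ) (κ : ℝ) (x : ℝ) : ℂ :=
  x + Complex.I * (√(κ ^ 2 - Metric.infDist (x : ℂ) K ^ 2) : ℝ)

/-- The point of the lower half of `𝒞_κ` over `x`. -/
def contourLower (K : Set ℂ) (κ : ℝ) (x : ℝ) : ℂ :=
  x - Complex.I * (√(κ ^ 2 - Metric.infDist (x : ℂ) K ^ 2) : ℝ)

/-- The integral `∫_{𝒞_κ} g(z) dz` converges absolutely. -/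
def ContourIntegrable {E : Type} [NormedAddCommGroup E] [NormedSpace ℂ E]
    (K : Set ℂ) (κ : ℝ) (g : ℂ → E) : Prop :=
  MeasureTheory.IntegrableOn
      (fun x => deriv (contourLower K κ) x • g (contourLower K κ x)) (contourBase K κ) ∧
    MeasureTheory.IntegrableOn
      (fun x => deriv (contourUpper K κ) x • g (contourUpper K κ x)) (contourBase K κ)

/-- The contour integral `∫_{𝒞_κ} g(z) dz`, counterclockwise. -/
def contourIntegral {E : Type} [NormedAddCommGroup E] [NormedSpace ℂ E]
    (K : Set ℂ) (κ : ℝ) (g : ℂ → E) : E :=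
  (∫ x in contourBase K κ, deriv (contourLower K κ) x • g (contourLower K κ x)) -
    ∫ x in contourBase K κ, deriv (contourUpper K κ) x • g (contourUpper K κ x)

/-- `Φ̄ = (1 / 2π) ∫_{𝒞_κ} |Φ(z)| |dz|`. -/
def contourMean (K : Set ℂ) (κ : ℝ) (Φ : ℂ → ℂ) : ℝ :=
  1 / (2 * Real.pi) *
    ((∫ x in contourBase K κ, ‖Φ (contourLower K κ x)‖ * ‖deriv (contourLower K κ) x‖) +
      ∫ x in contourBase K κ, ‖Φ (contourUpper K κ x)‖ * ‖deriv (contourUpper K κ) x‖)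

/-- The analytic functional calculus `Φ(a) = (i / 2π) ∮_{𝒞_κ} Φ(z) (a - z 1)⁻¹ dz`, taken along the
contour `𝒞_κ` at distance `κ` around a compact set `K` of real numbers which contains `σ(a)`,
for `Φ` analytic on `{z | dist(z, K) ≤ κ}`. -/
def analyticCalc {A : Type} [NormedRing A] [NormedAlgebra ℂ A]
    (K : Set ℂ) (κ : ℝ) (Φ : ℂ → ℂ) (a : A) : A :=
  (Complex.I / (2 * Real.pi)) • contourIntegral K κ fun z => Φ z • res a z

/-! ### The periodic algebra and the torus algebra -/

/-- The Euclidean norm `|n|` of a lattice point. -/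
def latticeNorm {d : ℕ} (n : Fin d → ℤ) : ℝ := √(∑ i, (n i : ℝ) ^ 2)

/-- `A_d(ξ) = ∑_{γ ∈ ℤ^d} e^{-ξ|γ|}`. -/
def latticeSum (d : ℕ) (ξ : ℝ) : ℝ := ∑' γ : Fin d → ℤ, Real.exp (-ξ * latticeNorm γ)

/-- The range `[-1/2, 1/2]` of the random amplitudes. -/
abbrev Amplitude : Type := Set.Icc (-(1 / 2) : ℝ) (1 / 2)

/-- `Ω = [-1/2, 1/2]^{ℤ^d}`. -/
abbrev Omega (d : ℕ) : Type := (Fin d → ℤ) → Amplitude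

/-- `(𝔱_m ω)_n = ω_{n+m}`. -/
def translate {d : ℕ} (m : Fin d → ℤ) (ω : Omega d) : Omega d := fun n => ω (n + m)

theorem continuous_translate {d : ℕ} (m : Fin d → ℤ) : Continuous (translate m) :=
  continuous_pi fun n => continuous_apply (n + m)

/-- `Ω_per`, the configurations which are periodic of period `2N + 1` in every direction. -/
abbrev OmegaPer (d N : ℕ) : Type :=
  {ω : Omega d // ∀ j : Fin d, translate (Pi.single j (2 * (N : ℤ) + 1)) ω = ω}

instance instCompactSpaceOmegaPer {d N : ℕ} : CompactSpace (OmegaPer d N) := by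
  have h : IsClosed (⋂ j : Fin d,
      {ω : Omega d | translate (Pi.single j (2 * (N : ℤ) + 1)) ω = ω}) :=
    isClosed_iInter fun j => isClosed_eq (continuous_translate _) continuous_id
  have e : (⋂ j : Fin d, {ω : Omega d | translate (Pi.single j (2 * (N : ℤ) + 1)) ω = ω})
      = {ω : Omega d | ∀ j : Fin d, translate (Pi.single j (2 * (N : ℤ) + 1)) ω = ω} := by
    ext ω
    simp
  rw [e] at h
  exact isCompact_iff_compactSpace.1 h.isCompact

/-- `x · F · y = ∑_{j,k} x_j F_{jk} y_k`. -/
def magForm {d : ℕ} (F : Matrix (Fin d) (Fin d) ℝ) (x y : Fin d → ℤ) : ℝ :=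
  ∑ j, ∑ k, (x j : ℝ) * F j k * (y k : ℝ)

/-- `e^{iπ x·F·y}`. -/
def magPhase {d : ℕ} (F : Matrix (Fin d) (Fin d) ℝ) (x y : Fin d → ℤ) : ℂ :=
  Complex.exp (Complex.I * Real.pi * (magForm F x y : ℂ))

theorem norm_magPhase {d : ℕ} (F : Matrix (Fin d) (Fin d) ℝ) (x y : Fin d → ℤ) :
    ‖magPhase F x y‖ = 1 := by
  have : Complex.I * Real.pi * (magForm F x y : ℂ)
      = ((Real.pi * magForm F x y : ℝ) : ℂ) * Complex.I := by
    push_cast; ring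
  rw [magPhase, this, Complex.norm_exp_ofReal_mul_I]

theorem magForm_add_left {d : ℕ} (F : Matrix (Fin d) (Fin d) ℝ) (x x' y : Fin d → ℤ) :
    magForm F (x + x') y = magForm F x y + magForm F x' y := by
  simp only [magForm, ← Finset.sum_add_distrib]
  refine Finset.sum_congr rfl fun j _ => Finset.sum_congr rfl fun k _ => ?_
  rw [Pi.add_apply]; push_cast; ring

theorem magForm_swap {d : ℕ} (F : Matrix (Fin d) (Fin d) ℝ) (hF : F.transpose = -F)
    (x y : Fin d → ℤ) : magForm F y x = -magForm F x y := by
  simp only [magForm, ← Finset.sum_neg_distrib]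
  rw [Finset.sum_comm]
  refine Finset.sum_congr rfl fun j _ => Finset.sum_congr rfl fun k _ => ?_
  have h := congrFun (congrFun hF j) k
  rw [Matrix.transpose_apply, Matrix.neg_apply] at h
  rw [h]; ring

theorem magPhase_add_left {d : ℕ} (F : Matrix (Fin d) (Fin d) ℝ) (x x' y : Fin d → ℤ) :
    magPhase F (x + x') y = magPhase F x y * magPhase F x' y := by
  rw [magPhase, magPhase, magPhase, ← Complex.exp_add, magForm_add_left]
  push_cast
  congr 1; ring

theorem magPhase_swap {d : ℕ} (F : Matrix (Fin d) (Fin d) ℝ) (hF : F.transpose = -F)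
    (x y : Fin d → ℤ) : magPhase F y x = (magPhase F x y)⁻¹ := by
  rw [magPhase, magPhase, ← Complex.exp_neg, magForm_swap F hF]
  push_cast
  congr 1; ring

theorem magPhase_self {d : ℕ} (F : Matrix (Fin d) (Fin d) ℝ) (hF : F.transpose = -F)
    (x : Fin d → ℤ) : magPhase F x x = 1 := by
  have h := magForm_swap F hF x x
  have h0 : magForm F x x = 0 := by linarith
  simp [magPhase, h0]

/-- The system behind the periodic C*-algebra `C*(Ω_per × ℤ^d, F)`. -/
def perSystem {d : ℕ} (N : ℕ) (F : Matrix (Fin d) (Fin d) ℝ) (hF : F.transpose = -F) :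
    MagneticSystem (Fin d → ℤ) (OmegaPer d N) where
  shift m ω := ⟨translate m ω.1, fun j => by
    have h := ω.2 j
    funext n
    have hn := congrFun h (n + m)
    simp only [translate] at hn ⊢
    rw [add_right_comm]
    exact hn⟩
  continuous_shift m :=
    Continuous.subtype_mk ((continuous_translate m).comp continuous_subtype_val) _
  shift_zero ω := by
    refine Subtype.ext (funext fun n => ?_)
    simp [translate]
  shift_add m n ω := by
    refine Subtype.ext (funext fun k => ?_)
    simp [translate, add_assoc]
  phase := magPhase F
  norm_phase := norm_magPhase F
  phase_self := magPhase_self F hF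
  phase_add_left := magPhase_add_left F
  phase_add_right n m m' := by
    rw [magPhase_swap F hF (m + m') n, magPhase_swap F hF m n, magPhase_swap F hF m' n,
      magPhase_add_left, mul_inv]

/-- The discrete torus `𝕋_d` with `2N + 1` points on each circle. The rotation `𝔯_p` is the
addition of `p`. -/
abbrev Torus (d N : ℕ) : Type := Fin d → ZMod (2 * N + 1)

/-- The coordinates `n_p ∈ {-N, …, N}^d` of a point of the torus. -/
def coord {d N : ℕ} (p : Torus d N) : Fin d → ℤ := fun i => (p i).valMinAbs

/-- `Ω_N = [-1/2, 1/2]^{𝕋_d}`. -/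
abbrev OmegaTor (d N : ℕ) : Type := Torus d N → Amplitude

theorem coord_add {d N : ℕ} (p q : Torus d N) :
    ∃ s : Fin d → ℤ, coord (p + q) = coord p + coord q + fun i => (2 * (N : ℤ) + 1) * s i := by
  have h : ∀ i, ∃ s : ℤ,
      coord (p + q) i = coord p i + coord q i + (2 * (N : ℤ) + 1) * s := by
    intro i
    have h0 : ((coord (p + q) i - (coord p i + coord q i) : ℤ) : ZMod (2 * N + 1)) = 0 := by
      simp [coord]
    obtain ⟨s, hs⟩ := (ZMod.intCast_zmod_eq_zero_iff_dvd _ _).1 h0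
    refine ⟨s, ?_⟩
    push_cast at hs
    linarith
  choose s hs using h
  exact ⟨s, funext hs⟩

theorem magPhase_period {d N : ℕ} (F : Matrix (Fin d) (Fin d) ℝ)
    (hQ : ∀ i j, ∃ k : ℤ, F i j = 2 / (2 * N + 1) * k) (s y : Fin d → ℤ) :
    magPhase F (fun i => (2 * (N : ℤ) + 1) * s i) y = 1 := by
  choose k hk using hQ
  have hN : (2 * (N : ℝ) + 1) ≠ 0 := by positivity
  have e : magForm F (fun i => (2 * (N : ℤ) + 1) * s i) y
      = 2 * ((∑ i, ∑ j, s i * k i j * y j : ℤ) : ℝ) := by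
    simp only [magForm]
    push_cast
    rw [Finset.mul_sum]
    refine Finset.sum_congr rfl fun i _ => ?_
    rw [Finset.mul_sum]
    refine Finset.sum_congr rfl fun j _ => ?_
    rw [hk]
    field_simp
  rw [magPhase, Complex.exp_eq_one_iff]
  refine ⟨∑ i, ∑ j, s i * k i j * y j, ?_⟩
  rw [e]
  push_cast
  ring

theorem torPhase_add_left {d N : ℕ} (F : Matrix (Fin d) (Fin d) ℝ)
    (hQ : ∀ i j, ∃ k : ℤ, F i j = 2 / (2 * N + 1) * k) (p p' q : Torus d N) :
    magPhase F (coord (p + p')) (coord q)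
      = magPhase F (coord p) (coord q) * magPhase F (coord p') (coord q) := by
  obtain ⟨s, hs⟩ := coord_add p p'
  rw [hs, magPhase_add_left, magPhase_add_left, magPhase_period F hQ, mul_one]

/-- The system behind the torus algebra `C*(Ω_N × 𝕋_d, F)`. The quantization of `F` is what makes
the operator representation multiplicative. -/
def torSystem {d : ℕ} (N : ℕ) (F : Matrix (Fin d) (Fin d) ℝ) (hF : F.transpose = -F)
    (hQ : ∀ i j, ∃ k : ℤ, F i j = 2 / (2 * N + 1) * k) :
    MagneticSystem (Torus d N) (OmegaTor d N) where
  shift q ω := fun p => ω (p + q)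
  continuous_shift q := continuous_pi fun p => continuous_apply (p + q)
  shift_zero ω := by simp
  shift_add m n ω := by
    funext k
    simp [add_assoc]
  phase p q := magPhase F (coord p) (coord q)
  norm_phase _ _ := norm_magPhase F _ _
  phase_self p := magPhase_self F hF _
  phase_add_left := torPhase_add_left F hQ
  phase_add_right n m m' := by
    rw [magPhase_swap F hF (coord (m + m')) _, magPhase_swap F hF (coord m) _,
      magPhase_swap F hF (coord m') _, torPhase_add_left F hQ, mul_inv]

/-- The canonical identification of `Ω_N` with `Ω_per`: periodic repetition. -/
def unroll {d N : ℕ} : C(OmegaTor d N, OmegaPer d N) where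
  toFun ω := ⟨fun n => ω fun i => (n i : ZMod (2 * N + 1)), fun j => by
    funext n
    simp only [translate]
    congr 1
    funext i
    by_cases h : i = j
    · subst h
      have := ZMod.natCast_self (2 * N + 1)
      push_cast at this
      simp [this]
    · simp [h]⟩
  continuous_toFun := Continuous.subtype_mk (continuous_pi fun _ => continuous_apply _) _

/-- The canonical identification of `Ω_per` with `Ω_N`: restriction to one cell. -/
def rollUp {d N : ℕ} : C(OmegaPer d N, OmegaTor d N) where
  toFun ω := fun p => ω.1 (coord p)
  continuous_toFun :=
    continuous_pi fun p => (continuous_apply (coord p)).comp continuous_subtype_val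

section Bridge

variable {d : ℕ} (N : ℕ) (F : Matrix (Fin d) (Fin d) ℝ) (hF : F.transpose = -F)
  (hQ : ∀ i j, ∃ k : ℤ, F i j = 2 / (2 * N + 1) * k)

/-- `(Pf)(ω, p) = f(ω, n_p)`. -/
def mapP (f : (perSystem N F hF).Alg) : (torSystem N F hF hQ).Alg :=
  (torSystem N F hF hQ).ofKern (Finsupp.equivFunOnFinite.symm fun p =>
    ((perSystem N F hF).kernel f (coord p)).comp unroll)

/-- `(Jf̃)(ω, n) = ∑_q δ_{n, n_q} f̃(ω, q)`. -/
def mapJ (f : (torSystem N F hF hQ).Alg) : (perSystem N F hF).Alg :=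
  (perSystem N F hF).ofKern (∑ q : Torus d N,
    Finsupp.single (coord q) (((torSystem N F hF hQ).kernel f q).comp rollUp))

end Bridge

/-! ### The nearest-neighbour hopping Hamiltonian -/

theorem mem_box_of_latticeNorm {d : ℕ} (n : Fin d → ℤ) (h : latticeNorm n = 1 ∨ n = 0) :
    n ∈ Fintype.piFinset fun _ : Fin d => Finset.Icc (-1 : ℤ) 1 := by
  rw [Fintype.mem_piFinset]
  intro i
  rcases h with h | h
  · have h1 : (n i : ℝ) ^ 2 ≤ 1 := by
      rw [latticeNorm, Real.sqrt_eq_one] at h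
      rw [← h]
      exact Finset.single_le_sum (f := fun i => (n i : ℝ) ^ 2) (fun i _ => sq_nonneg _)
        (Finset.mem_univ i)
    have h2 : (n i) ^ 2 ≤ 1 := by exact_mod_cast h1
    rw [Finset.mem_Icc]
    constructor <;> nlinarith
  · subst h
    simp

/-- The nearest-neighbour hopping Hamiltonian `h(ω, n) = δ_{|n|,1} + W ω_n δ_{n,0}`, as a function
on `Ω × ℤ^d`. -/
def hamiltonian (d : ℕ) (W : ℝ) : Kern (Fin d → ℤ) (Omega d) := by
  classical
  exact Finsupp.onFinset (Fintype.piFinset fun _ : Fin d => Finset.Icc (-1 : ℤ) 1)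
    (fun n => ⟨fun ω => (if latticeNorm n = 1 then 1 else 0)
      + (W : ℂ) * ((ω n : ℝ) : ℂ) * (if n = 0 then 1 else 0), by fun_prop⟩)
    (by
      intro n hn
      refine mem_box_of_latticeNorm n ?_
      by_contra hc
      rw [not_or] at hc
      apply hn
      ext ω
      simp [hc.1, hc.2])

/-- The restriction of the configurations to `Ω_per`. -/
def restrictPer {d : ℕ} (N : ℕ) (f : Kern (Fin d → ℤ) (Omega d)) :
    Kern (Fin d → ℤ) (OmegaPer d N) :=
  f.mapRange (fun c => c.comp ⟨Subtype.val, continuous_subtype_val⟩) (by ext; rfl)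

/-- The Hamiltonian `h̃` on the torus: the image under `P` of the restriction of `h` to `Ω_per`. -/
def torHamiltonian {d : ℕ} (N : ℕ) (W : ℝ) (F : Matrix (Fin d) (Fin d) ℝ)
    (hF : F.transpose = -F) (hQ : ∀ i j, ∃ k : ℤ, F i j = 2 / (2 * N + 1) * k) :
    (torSystem N F hF hQ).Alg :=
  mapP N F hF hQ ((perSystem N F hF).ofKern (restrictPer N (hamiltonian d W)))

/-- `Jh̃`, the Hamiltonian in the periodic algebra. -/
def perHamiltonian {d : ℕ} (N : ℕ) (W : ℝ) (F : Matrix (Fin d) (Fin d) ℝ)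
    (hF : F.transpose = -F) (hQ : ∀ i j, ∃ k : ℤ, F i j = 2 / (2 * N + 1) * k) :
    (perSystem N F hF).Alg :=
  mapJ N F hF hQ (torHamiltonian N W F hF hQ)

/-- The spectrum `σ(h̃)` in the torus algebra. -/
def torSpectrum {d : ℕ} (N : ℕ) (W : ℝ) (F : Matrix (Fin d) (Fin d) ℝ)
    (hF : F.transpose = -F) (hQ : ∀ i j, ∃ k : ℤ, F i j = 2 / (2 * N + 1) * k) : Set ℂ :=
  spectrum ℂ (torHamiltonian N W F hF hQ)

/-- The spectrum `σ(Jh̃)` in the periodic algebra. -/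
def perSpectrum {d : ℕ} (N : ℕ) (W : ℝ) (F : Matrix (Fin d) (Fin d) ℝ)
    (hF : F.transpose = -F) (hQ : ∀ i j, ∃ k : ℤ, F i j = 2 / (2 * N + 1) * k) : Set ℂ :=
  spectrum ℂ (perHamiltonian N W F hF hQ)

end NCTorus

end

open NCTorus

namespace NCTorus

/-! ### Resolvents in C*-algebras -/

/-! Write T for the torus Hamiltonian, H for the periodic one and R for the resolvent of H at z. The
map P is linear but not multiplicative, and the comparison rests on the geometric resolvent identity
(T - z)⁻¹ - P R = -(T - z)⁻¹ ((T - z) P R - 1). Both Hamiltonians are nearest-neighbour operators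
with the same potential and, because the flux is quantized, the same phases. Hence (T - z) P R
agrees with P((H - z) R) = 1 except where a step leaves the cell {-N, …, N}^d: there the torus wraps
around and the kernel of R is evaluated at the opposite face instead of just outside the cell
(`kernel_torHamiltonian_sub_mul_mapP`).

At all these points R is small, by the Combes–Thomas bound `norm_kernel_inverse_le`: conjugating a
nearest-neighbour operator with an exponential weight of slope ξ changes it by at most 2d sinh ξ in
norm, so invertibility with gap δ survives while 2d sinh ξ < δ. On a torus, which is finite, the
norm is at most the ℓ¹ sum of the kernel. A point on a face splits into a coordinate of size at
least N and a point γ of ℤ^(d-1), and |n| ≥ (N + |γ|)/√2; summing over γ gives e^(-ξN/√2)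
A_(d-1)(ξ/√2). There are 2d steps with two kernel values each, hence a factor 4d. The remaining
factor ‖(T - z)⁻¹‖ is at most 1/dist(z, σ(T)), since T is self-adjoint.

All this needs σ(T) ⊆ σ(H) (`torSpectrum_subset`). An eigenvector on the torus unrolls to a bounded
periodic solution on ℤ^d; damped by e^(-ε|n|) it becomes a square-summable approximate eigenvector
of H, with relative error tending to 0 with ε.

For the functional calculus the resolvent bound is integrated over the contour, on which dist(z,
σ(H)) = κ and, by the inclusion of the spectra, dist(z, σ(T)) ≥ κ. P is bounded, so it passes
through the integral. Absolute convergence reduces to the finite length of the contour, which is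
dominated by finitely many half circles (`integrableOn_speedBound`). -/

theorem isUnit_sub_algebraMap {A : Type} [Ring A] [Algebra ℂ A] {a : A} {z : ℂ}
    (hz : z ∉ spectrum ℂ a) : IsUnit (a - algebraMap ℂ A z) := by
  have h := spectrum.notMem_iff.1 hz
  rw [← neg_sub] at h
  exact (IsUnit.neg_iff _).1 h

/-- By the continuous functional calculus the resolvent is the function x ↦ (x - z)⁻¹ of `a`, and
its supremum over the spectrum is controlled by the distance to z. -/
theorem norm_res_le {A : Type} [CStarAlgebra A] [Nontrivial A] {a : A} (ha : IsSelfAdjoint a)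
    {z : ℂ} (hz : z ∉ spectrum ℂ a) :
    ‖res a z‖ ≤ (Metric.infDist z (spectrum ℂ a))⁻¹ := by
  have hn : IsStarNormal a := ha.isStarNormal
  have h1 : res a z = cfc (fun x : ℂ => (x - z)⁻¹) a := by
    rw [cfc_inv (fun x : ℂ => x - z) a (fun x hx h0 => hz (by rwa [← sub_eq_zero.1 h0])),
      cfc_sub (fun x => x) (fun _ => z) a, cfc_const z a, cfc_id' ℂ a, res]
  rw [h1]
  refine norm_cfc_le (inv_nonneg.2 Metric.infDist_nonneg) fun x hx => ?_
  have h0 : 0 < Metric.infDist z (spectrum ℂ a) :=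
    ((spectrum.isClosed a).notMem_iff_infDist_pos (spectrum.nonempty a)).1 hz
  rw [norm_inv]
  refine inv_anti₀ h0 ?_
  rw [← dist_eq_norm, dist_comm]
  exact Metric.infDist_le_dist_of_mem hx

/-! ### Nearest-neighbour operators -/

section HopKern

variable {G Ω ι : Type} [AddCommGroup G] [TopologicalSpace Ω] [Fintype ι]

/-- The kernel of a nearest-neighbour operator, with potential `V` and unit hopping along the
steps `e i`. -/
noncomputable def hopKern (e : ι → G) (V : C(Ω, ℂ)) : Kern G Ω :=
  Finsupp.single 0 V + ∑ i, Finsupp.single (e i) 1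

theorem hopKern_apply [DecidableEq G] (e : ι → G) (V : C(Ω, ℂ)) (n : G) (ω : Ω) :
    hopKern e V n ω = (if n = 0 then V ω else 0) + ∑ i, if n = e i then 1 else 0 := by
  rw [hopKern, Finsupp.add_apply, ContinuousMap.add_apply, Finsupp.finsetSum_apply,
    ContinuousMap.sum_apply, Finsupp.single_apply]
  congr 1
  · simp only [eq_comm]; split_ifs <;> rfl
  · refine Finset.sum_congr rfl fun i _ => ?_
    rw [Finsupp.single_apply]
    simp only [eq_comm]; split_ifs <;> rfl

end HopKern

/-! ### Elements of the C*-algebra as kernels -/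

section System

theorem continuous_entry {G Ω : Type} [AddCommGroup G] (ω : Ω) (m n : G) :
    Continuous fun a : Fam G Ω => a ω (ket m) n := by
  refine LipschitzWith.continuous (K := 1) (LipschitzWith.of_dist_le_mul fun a b => ?_)
  rw [dist_eq_norm, dist_eq_norm, NNReal.coe_one, one_mul]
  have h1 := lp.norm_apply_le_norm (p := ∞) ENNReal.top_ne_zero (a - b) ω
  have h2 := ((a - b) ω).le_opNorm (ket m)
  have h3 := lp.norm_apply_le_norm (p := 2) (by norm_num) (((a - b) ω) (ket m)) n
  rw [norm_ket, mul_one] at h2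
  exact (h3.trans h2).trans h1

variable {G Ω : Type} [AddCommGroup G] [TopologicalSpace Ω] [CompactSpace Ω]

namespace MagneticSystem

/-- The matrix entries of an element of the C*-algebra are those of its kernel. -/
theorem entry_eq (S : MagneticSystem G Ω) (a : S.Alg) (ω : Ω) (m n : G) :
    (a : Fam G Ω) ω (ket m) n = S.kernel a (m - n) (S.shift (-n) ω) * S.phase m n := by
  -- Both sides are continuous in the element, so the covariance relation need only be checked on
  -- the dense core.
  have hcl : IsClosed {a : Fam G Ω |
      a ω (ket m) n = a (S.shift (-n) ω) (ket (m - n)) 0 * S.phase m n} :=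
    isClosed_eq (continuous_entry ω m n)
      ((continuous_entry (S.shift (-n) ω) (m - n) 0).mul continuous_const)
  have hsub : (S.core : Set (Fam G Ω)) ⊆ {a : Fam G Ω |
      a ω (ket m) n = a (S.shift (-n) ω) (ket (m - n)) 0 * S.phase m n} := by
    rintro _ ⟨f, rfl⟩
    change S.rep f ω (ket m) n = S.rep f (S.shift (-n) ω) (ket (m - n)) 0 * S.phase m n
    rw [S.rep_ket, S.rep_ket, S.phase_zero_right, neg_zero, S.shift_zero, sub_zero, mul_one]
  exact closure_minimal hsub hcl a.2

theorem alg_ext (S : MagneticSystem G Ω) {a b : S.Alg}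
    (h : ∀ n ω, S.kernel a n ω = S.kernel b n ω) : a = b := by
  refine Subtype.ext (lp.ext (funext fun ω => op_ext fun m n => ?_))
  rw [S.entry_eq, S.entry_eq, h]

theorem kernel_sub (S : MagneticSystem G Ω) (a b : S.Alg) (n : G) :
    S.kernel (a - b) n = S.kernel a n - S.kernel b n := rfl

theorem kernel_add (S : MagneticSystem G Ω) (a b : S.Alg) (n : G) :
    S.kernel (a + b) n = S.kernel a n + S.kernel b n := rfl

theorem kernel_smul (S : MagneticSystem G Ω) (c : ℂ) (a : S.Alg) (n : G) :
    S.kernel (c • a) n = c • S.kernel a n := rfl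

theorem norm_kernel_le (S : MagneticSystem G Ω) (a : S.Alg) (n : G) : ‖S.kernel a n‖ ≤ ‖a‖ := by
  refine (ContinuousMap.norm_le _ (norm_nonneg _)).2 fun ω => ?_
  have h1 := lp.norm_apply_le_norm (p := ∞) ENNReal.top_ne_zero (a : Fam G Ω) ω
  have h2 := ((a : Fam G Ω) ω).le_opNorm (ket n)
  have h3 := lp.norm_apply_le_norm (p := 2) (by norm_num) (((a : Fam G Ω) ω) (ket n)) 0
  rw [norm_ket, mul_one] at h2
  exact (h3.trans h2).trans h1

theorem kernel_one (S : MagneticSystem G Ω) [DecidableEq G] (n : G) (ω : Ω) :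
    S.kernel 1 n ω = if n = 0 then 1 else 0 := by
  change (ket n : L2 G) 0 = _
  rw [ket_apply]
  simp only [eq_comm]

theorem norm_ofKern_le (S : MagneticSystem G Ω) (f : Kern G Ω) :
    ‖S.ofKern f‖ ≤ ∑ k ∈ f.support, ‖f k‖ :=
  lp.norm_le_of_forall_le (Finset.sum_nonneg fun _ _ => norm_nonneg _) fun ω => S.norm_rep_le f ω

/-- For a finite group every element is a finitely supported function, and each hop contributes at
most its sup norm. This turns pointwise decay of kernels into norm estimates on the torus. -/
theorem norm_le_sum_kernel [Fintype G] (S : MagneticSystem G Ω) (a : S.Alg) :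
    ‖a‖ ≤ ∑ k, ‖S.kernel a k‖ := by
  have h : a = S.ofKern (Finsupp.equivFunOnFinite.symm (S.kernel a)) :=
    S.alg_ext fun n ω => by rw [S.kernel_ofKern]; rfl
  conv_lhs => rw [h]
  refine (S.norm_ofKern_le _).trans ?_
  exact Finset.sum_le_sum_of_subset_of_nonneg (Finset.subset_univ _) fun _ _ _ => norm_nonneg _

variable {ι : Type} [Fintype ι] (e : ι → G) (V : C(Ω, ℂ))

theorem rep_hopKern (S : MagneticSystem G Ω) (ω : Ω) (φ : L2 G) (n : G) :
    S.rep (hopKern e V) ω φ n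
      = V (S.shift (-n) ω) * φ n + ∑ i, S.phase (n + e i) n * φ (n + e i) := by
  classical
  have hs : (hopKern e V).support ⊆ insert 0 (Finset.univ.image e) := by
    intro k hk
    by_contra h
    simp only [Finset.mem_insert, Finset.mem_image, Finset.mem_univ, true_and, not_or,
      not_exists] at h
    refine Finsupp.mem_support_iff.1 hk (ContinuousMap.ext fun ω => ?_)
    rw [hopKern_apply, if_neg h.1, Finset.sum_eq_zero, add_zero]
    · rfl
    · exact fun i _ => if_neg fun h' => h.2 i h'.symm
  rw [S.rep_apply_of_subset _ ω φ n _ hs]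
  simp only [hopKern_apply, add_mul, ite_mul, zero_mul, Finset.sum_mul, one_mul,
    Finset.sum_add_distrib]
  congr 1
  · rw [Finset.sum_ite_eq' _ (0 : G), if_pos (Finset.mem_insert_self _ _), add_zero, S.phase_self,
      mul_one]
  · rw [Finset.sum_comm]
    refine Finset.sum_congr rfl fun i _ => ?_
    rw [Finset.sum_ite_eq' _ (e i), if_pos]
    exact Finset.mem_insert_of_mem (Finset.mem_image_of_mem e (Finset.mem_univ i))

/-- The spectral parameter is absorbed into the potential; for this reason the nearest-neighbour
estimates allow a complex `V`. -/
theorem ofKern_hopKern_sub (S : MagneticSystem G Ω) (z : ℂ) :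
    S.ofKern (hopKern e V) - algebraMap ℂ S.Alg z
      = S.ofKern (hopKern e (V - ContinuousMap.const Ω z)) := by
  have h : S.ofKern (hopKern e V)
      = S.ofKern (hopKern e (V - ContinuousMap.const Ω z)) + algebraMap ℂ S.Alg z := by
    refine Subtype.ext ?_
    change S.family _ = S.family _ + algebraMap ℂ (Fam G Ω) z
    rw [← S.family_scalar, ← S.family_add]
    congr 1
    rw [hopKern, hopKern, Finsupp.single_sub]
    abel
  rw [h, add_sub_cancel_right]

/-- The kernel of a product is the entry at the origin of the first factor applied to a column of
the second, so only the neighbours of `n` enter. -/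
theorem kernel_hopKern_mul (S : MagneticSystem G Ω) (b : S.Alg) (n : G) (ω : Ω) :
    S.kernel (S.ofKern (hopKern e V) * b) n ω
      = V ω * S.kernel b n ω
        + ∑ i, S.kernel b (n - e i) (S.shift (-e i) ω) * S.phase n (e i) := by
  change S.rep (hopKern e V) ω ((b : Fam G Ω) ω (ket n)) 0 = _
  rw [S.rep_hopKern]
  simp only [zero_add, S.entry_eq, S.phase_zero_right, neg_zero, S.shift_zero, mul_one, one_mul,
    sub_zero]

theorem isSelfAdjoint_hopKern (S : MagneticSystem G Ω) (σ : ι ≃ ι) (hσ : ∀ i, e (σ i) = -e i)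
    (hV : ∀ ω, (starRingEnd ℂ) (V ω) = V ω) : IsSelfAdjoint (S.ofKern (hopKern e V)) := by
  classical
  have h : S.adj (hopKern e V) = hopKern e V := by
    ext n ω
    rw [S.adj_apply, hopKern_apply, hopKern_apply, map_add, map_sum]
    congr 1
    · by_cases hn : n = 0
      · simp [hn, S.shift_zero, hV]
      · simp [hn]
    · rw [← Equiv.sum_comp σ]
      refine Finset.sum_congr rfl fun i _ => ?_
      rw [hσ]
      simp only [neg_inj]
      split_ifs <;> simp
  refine Subtype.ext ?_
  change star (S.family _) = S.family _
  rw [← S.family_adj, h]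

/-- Multiplication by a weight `D` almost commutes with nearest-neighbour operators: if `D⁻¹φ` is
formally mapped to `D⁻¹χ`, then `φ` is mapped close to `χ`. -/
theorem norm_rep_hopKern_sub_le (S : MagneticSystem G Ω) (ω : Ω) (D : G → ℝ)
    (hD : ∀ n, 0 < D n) (c : ι → ℝ) (hc : ∀ i n, |1 - D n / D (n + e i)| ≤ c i)
    (φ χ : L2 G) (Ψ : G → ℂ) (hφ : ∀ n, φ n = D n * Ψ n)
    (hχ : ∀ n, χ n = D n
      * (V (S.shift (-n) ω) * Ψ n + ∑ i, S.phase (n + e i) n * Ψ (n + e i))) :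
    ‖S.rep (hopKern e V) ω φ - χ‖ ≤ (∑ i, c i) * ‖φ‖ := by
  have hb : ∀ i n, ‖S.phase (n + e i) n * ((1 - D n / D (n + e i) : ℝ) : ℂ)‖ ≤ c i :=
    fun i n => by
      rw [norm_mul, Complex.norm_real, Real.norm_eq_abs, S.norm_phase, one_mul]
      exact hc i n
  -- The weight commutes with the potential, which cancels. Each hopping term survives with the
  -- factor `1 - D n / D (n + e i)`.
  have key : S.rep (hopKern e V) ω φ - χ = ∑ i, hop (e i) _ (c i) (hb i) φ := by
    ext n
    rw [lp.coeFn_sub, Pi.sub_apply, S.rep_hopKern, hχ, hφ n, mul_add, Finset.mul_sum,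
      mul_left_comm, add_sub_add_left_eq_sub,
      ← Finset.sum_sub_distrib, lp.coeFn_sum, Finset.sum_apply]
    refine Finset.sum_congr rfl fun i _ => ?_
    rw [hop_apply, hφ]
    have h0 : (D (n + e i) : ℂ) ≠ 0 := by exact_mod_cast (hD _).ne'
    push_cast
    field_simp
  rw [key, Finset.sum_mul]
  refine (norm_sum_le _ _).trans (Finset.sum_le_sum fun i _ => ?_)
  exact ((hop _ _ _ (hb i)).le_opNorm φ).trans
    (mul_le_mul_of_nonneg_right (norm_hop_le _ _ _ _) (norm_nonneg _))

end MagneticSystem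

end System

/-! ### The lattice -/

theorem latticeNorm_nonneg {d : ℕ} (n : Fin d → ℤ) : 0 ≤ latticeNorm n := Real.sqrt_nonneg _

theorem latticeNorm_sq {d : ℕ} (n : Fin d → ℤ) : latticeNorm n ^ 2 = ∑ i, (n i : ℝ) ^ 2 :=
  Real.sq_sqrt (Finset.sum_nonneg fun _ _ => sq_nonneg _)

theorem latticeNorm_add_le {d : ℕ} (m n : Fin d → ℤ) :
    latticeNorm (m + n) ≤ latticeNorm m + latticeNorm n := by
  have h : ∀ k : Fin d → ℤ,
      latticeNorm k = ‖(WithLp.toLp 2 fun i => (k i : ℝ) : EuclideanSpace ℝ (Fin d))‖ := fun k => by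
    rw [EuclideanSpace.norm_eq, latticeNorm]
    simp
  rw [h, h, h]
  refine le_trans (le_of_eq ?_) (norm_add_le _ _)
  congr 1
  ext i
  simp

theorem abs_le_latticeNorm {d : ℕ} (n : Fin d → ℤ) (i : Fin d) : |(n i : ℝ)| ≤ latticeNorm n := by
  refine Real.abs_le_sqrt ?_
  exact Finset.single_le_sum (f := fun i => (n i : ℝ) ^ 2) (fun i _ => sq_nonneg _)
    (Finset.mem_univ i)

/-- This is (a + b)² ≤ 2(a² + b²) with a² + b² = |n|². It separates one coordinate from the others
at the price of √2, the origin of every ξ/√2. -/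
theorem le_latticeNorm_removeNth {d : ℕ} (j : Fin (d + 1)) (n : Fin (d + 1) → ℤ) :
    (|(n j : ℝ)| + latticeNorm (j.removeNth n)) / √2 ≤ latticeNorm n := by
  have h : latticeNorm n ^ 2 = |(n j : ℝ)| ^ 2 + latticeNorm (j.removeNth n) ^ 2 := by
    rw [latticeNorm_sq, latticeNorm_sq, Fin.sum_univ_succAbove _ j, sq_abs]
    rfl
  have h2 : (0 : ℝ) < √2 := by positivity
  rw [div_le_iff₀ h2]
  refine abs_le_of_sq_le_sq' ?_ (mul_nonneg (latticeNorm_nonneg _) h2.le) |>.2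
  rw [mul_pow, Real.sq_sqrt (by norm_num), h]
  nlinarith [sq_nonneg (|(n j : ℝ)| - latticeNorm (j.removeNth n))]

theorem summable_exp_neg_abs {ξ : ℝ} (hξ : 0 < ξ) :
    Summable fun a : ℤ => Real.exp (-ξ * |(a : ℝ)|) := by
  have h : Summable fun n : ℕ => Real.exp (-ξ * n) := by
    refine (summable_geometric_of_lt_one (Real.exp_nonneg (-ξ))
      (by rw [← Real.exp_zero, Real.exp_lt_exp]; linarith)).congr fun n => ?_
    rw [← Real.exp_nat_mul, mul_comm]
  exact Summable.of_nat_of_neg (by simpa using h) (by simpa using h)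

/-- Peeling off a coordinate bounds the series by a product of two summable ones at rate ξ/√2, hence
the induction over all rates. -/
theorem summable_exp_neg_latticeNorm (d : ℕ) {ξ : ℝ} (hξ : 0 < ξ) :
    Summable fun γ : Fin d → ℤ => Real.exp (-ξ * latticeNorm γ) := by
  induction d generalizing ξ with
  | zero => exact Summable.of_finite
  | succ d ih =>
    have h2 : (0 : ℝ) < ξ / √2 := by positivity
    have h := (summable_exp_neg_abs h2).mul_of_nonneg (ih h2) (fun _ => Real.exp_nonneg _)
      (fun _ => Real.exp_nonneg _)
    have h' := (Fin.insertNthEquiv (fun _ : Fin (d + 1) => ℤ) 0).symm.summable_iff.2 h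
    refine Summable.of_nonneg_of_le (fun _ => Real.exp_nonneg _) (fun γ => ?_) h'
    simp only [Function.comp_apply, Fin.insertNthEquiv_symm_apply]
    rw [← Real.exp_add, Real.exp_le_exp]
    have := mul_le_mul_of_nonneg_left (le_latticeNorm_removeNth 0 γ) hξ.le
    calc -ξ * latticeNorm γ ≤ -(ξ * ((|(γ 0 : ℝ)| + latticeNorm (Fin.removeNth 0 γ)) / √2)) := by
          linarith
      _ = _ := by ring

/-- The nearest neighbours `±e_j` of the origin. -/
def step {d : ℕ} (i : Fin d × Bool) : Fin d → ℤ := Pi.single i.1 (if i.2 then 1 else -1)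

/-- The involution which reverses a step. -/
def reverseStep (d : ℕ) : Fin d × Bool ≃ Fin d × Bool := (Equiv.refl _).prodCongr Equiv.boolNot

theorem step_reverseStep {d : ℕ} (i : Fin d × Bool) : step (reverseStep d i) = -step i := by
  obtain ⟨j, b⟩ := i
  cases b <;> simp [step, reverseStep, ← Pi.single_neg]

theorem step_injective {d : ℕ} : Function.Injective (step : Fin d × Bool → Fin d → ℤ) := by
  rintro ⟨j, b⟩ ⟨j', b'⟩ h
  have hj : j = j' := by
    by_contra hne
    have := congrFun h j
    simp only [step, Pi.single_eq_same, Pi.single_eq_of_ne hne] at this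
    split_ifs at this
    omega
  subst hj
  have := congrFun h j
  simp only [step, Pi.single_eq_same] at this
  cases b <;> cases b' <;> simp_all

theorem latticeNorm_step {d : ℕ} (i : Fin d × Bool) : latticeNorm (step i) = 1 := by
  rw [latticeNorm, Real.sqrt_eq_one, Finset.sum_eq_single i.1]
  · simp only [step, Pi.single_eq_same]
    split_ifs <;> simp
  · intro k _ hk
    simp [step, hk]
  · simp

/-- Integer squares with sum 1 are all zero but one, which is 1. -/
theorem exists_step_of_latticeNorm {d : ℕ} {n : Fin d → ℤ} (h : latticeNorm n = 1) :
    ∃ i, n = step i := by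
  rw [latticeNorm, Real.sqrt_eq_one] at h
  have h1 : ∑ i, n i ^ 2 = 1 := by exact_mod_cast h
  obtain ⟨j, -, hj⟩ := Finset.exists_ne_zero_of_sum_ne_zero (h1.trans_ne one_ne_zero)
  have hj1 : n j ^ 2 ≤ 1 := by
    rw [← h1]
    exact Finset.single_le_sum (f := fun i => n i ^ 2) (fun i _ => sq_nonneg _)
      (Finset.mem_univ j)
  have hj2 : n j ^ 2 = 1 := le_antisymm hj1 (by have := sq_nonneg (n j); omega)
  have hk : ∀ k, k ≠ j → n k = 0 := by
    intro k hk
    rw [← Finset.add_sum_erase _ _ (Finset.mem_univ j), hj2] at h1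
    have h0 : ∑ x ∈ Finset.univ.erase j, n x ^ 2 = 0 := by linarith
    have := (Finset.sum_eq_zero_iff_of_nonneg fun i _ => sq_nonneg (n i)).1 h0 k
      (Finset.mem_erase.2 ⟨hk, Finset.mem_univ k⟩)
    exact pow_eq_zero_iff two_ne_zero |>.1 this
  have hn : ∀ a : ℤ, n j = a → n = Pi.single j a := fun a ha => by
    funext k
    by_cases hkj : k = j
    · subst hkj; simpa using ha
    · simpa [hkj] using hk k hkj
  rcases (show n j = 1 ∨ n j = -1 from by simpa using hj2) with h | h
  · exact ⟨(j, true), hn 1 h⟩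
  · exact ⟨(j, false), hn (-1) h⟩

theorem ite_latticeNorm {d : ℕ} (n : Fin d → ℤ) :
    (if latticeNorm n = 1 then (1 : ℂ) else 0) = ∑ i, if n = step i then 1 else 0 := by
  by_cases h : latticeNorm n = 1
  · obtain ⟨i, rfl⟩ := exists_step_of_latticeNorm h
    rw [if_pos h, Finset.sum_eq_single i]
    · simp
    · intro k _ hk
      exact if_neg fun h' => hk (step_injective h'.symm)
    · simp
  · rw [if_neg h, Finset.sum_eq_zero]
    rintro i -
    refine if_neg fun h' => h ?_
    rw [h', latticeNorm_step]

/-! ### The decay of the resolvent -/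

section Decay

/-- The hypothesis has the shape supplied by `clamp_add_sub`: clamping the slope only shrinks the
increments of the weight. -/
theorem abs_one_sub_exp_le {s t : ℝ} (h : 0 ≤ t ∧ t ≤ s ∨ s ≤ t ∧ t ≤ 0) :
    |1 - Real.exp t| ≤ |1 - Real.exp s| := by
  rcases h with ⟨h0, h1⟩ | ⟨h1, h0⟩
  · have := Real.one_le_exp h0
    have := Real.exp_le_exp.2 h1
    rw [abs_of_nonpos (by linarith), abs_of_nonpos (by linarith)]
    linarith
  · have := Real.exp_le_one_iff.2 h0
    have := Real.exp_le_exp.2 h1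
    rw [abs_of_nonneg (by linarith), abs_of_nonneg (by linarith)]
    linarith

/-- The two differences have opposite signs, so the constants cancel and e^|a| - e^(-|a|) remains.
Pairing opposite steps in this way produces 2 sinh ξ rather than 2(e^ξ - 1). -/
theorem abs_one_sub_exp_add_le {a ξ : ℝ} (h : |a| ≤ ξ) :
    |1 - Real.exp a| + |1 - Real.exp (-a)| ≤ 2 * Real.sinh ξ := by
  have h1 : |1 - Real.exp a| + |1 - Real.exp (-a)| = 2 * Real.sinh |a| := by
    rw [Real.sinh_eq]
    rcases le_total 0 a with ha | ha
    · have := Real.one_le_exp ha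
      have := Real.exp_le_one_iff.2 (neg_nonpos.2 ha)
      rw [abs_of_nonneg ha, abs_of_nonpos (by linarith), abs_of_nonneg (by linarith)]
      ring
    · have := Real.one_le_exp (neg_nonneg.2 ha)
      have := Real.exp_le_one_iff.2 ha
      rw [abs_of_nonpos ha, abs_of_nonneg (by linarith), abs_of_nonpos (by linarith), neg_neg]
      ring
  rw [h1]
  exact mul_le_mul_of_nonneg_left (Real.sinh_le_sinh.2 h) two_pos.le

/-- The projection to the interval `[0, L]` is monotone and does not increase distances. -/
theorem clamp_add_sub {L : ℝ} (hL : 0 ≤ L) (u t : ℝ) :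
    0 ≤ max 0 (min (u + t) L) - max 0 (min u L) ∧ max 0 (min (u + t) L) - max 0 (min u L) ≤ t ∨
    t ≤ max 0 (min (u + t) L) - max 0 (min u L) ∧ max 0 (min (u + t) L) - max 0 (min u L) ≤ 0 := by
  rcases max_cases 0 (min (u + t) L) with h1 | h1 <;> rcases max_cases 0 (min u L) with h2 | h2 <;>
  rcases min_cases (u + t) L with h3 | h3 <;> rcases min_cases u L with h4 | h4 <;>
  rcases le_total 0 t with h5 | h5 <;>
  first
  | (left; constructor <;> linarith)
  | (right; constructor <;> linarith)

/-- The slope in the direction of `n` of the weight which detects the decay at `n`. -/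
noncomputable def slope {d : ℕ} (n m : Fin d → ℤ) : ℝ :=
  (∑ i, (n i : ℝ) * m i) / latticeNorm n

theorem slope_add {d : ℕ} (n m m' : Fin d → ℤ) : slope n (m + m') = slope n m + slope n m' := by
  simp only [slope, ← add_div, ← Finset.sum_add_distrib, Pi.add_apply]
  push_cast
  simp only [mul_add]

theorem slope_self {d : ℕ} (n : Fin d → ℤ) : slope n n = latticeNorm n := by
  have h := latticeNorm_sq n
  simp only [pow_two] at h
  rw [slope, ← h, mul_self_div_self]

theorem slope_step {d : ℕ} (n : Fin d → ℤ) (j : Fin d) (b : Bool) :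
    slope n (step (j, b)) = (if b then 1 else -1) * (n j / latticeNorm n) := by
  rw [slope, Finset.sum_eq_single j]
  · cases b <;> simp [step] ; ring
  · intro k _ hk
    simp [step, hk]
  · simp

theorem abs_div_latticeNorm_le {d : ℕ} (n : Fin d → ℤ) (j : Fin d) :
    |(n j : ℝ) / latticeNorm n| ≤ 1 := by
  rw [abs_div, abs_of_nonneg (latticeNorm_nonneg n)]
  exact div_le_one_of_le₀ (abs_le_latticeNorm n j) (latticeNorm_nonneg n)

variable {Ω : Type} [TopologicalSpace Ω] [CompactSpace Ω]

/-- Applying `r` in the fibre over `ω` recovers `φ` from its image, with a loss of at most `δ⁻¹`. -/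
theorem norm_le_of_left_inverse {G : Type} [AddCommGroup G] (S : MagneticSystem G Ω)
    (a r : S.Alg) (δ : ℝ) (hδ : 0 < δ) (hr : ‖r‖ ≤ δ⁻¹) (h : r * a = 1) (ω : Ω) (φ : L2 G) :
    δ * ‖φ‖ ≤ ‖(a : Fam G Ω) ω φ‖ := by
  have e : (r : Fam G Ω) ω ((a : Fam G Ω) ω φ) = φ := by
    change ((r * a : S.Alg) : Fam G Ω) ω φ = φ
    rw [h]
    rfl
  have h1 := lp.norm_apply_le_norm (p := ∞) ENNReal.top_ne_zero (r : Fam G Ω) ω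
  have h2 := ((r : Fam G Ω) ω).le_opNorm ((a : Fam G Ω) ω φ)
  rw [e] at h2
  have h3 : ‖φ‖ ≤ δ⁻¹ * ‖(a : Fam G Ω) ω φ‖ :=
    h2.trans (mul_le_mul_of_nonneg_right (h1.trans hr) (norm_nonneg _))
  rwa [← div_eq_inv_mul, le_div_iff₀' hδ] at h3

/-- The Combes–Thomas bound: the inverse of a nearest-neighbour operator decays exponentially. -/
theorem norm_kernel_inverse_le {d : ℕ} (S : MagneticSystem (Fin d → ℤ) Ω) (V : C(Ω, ℂ))
    (r : S.Alg) (δ ξ : ℝ) (hξ : 0 ≤ ξ) (hδξ : 2 * d * Real.sinh ξ < δ) (hr : ‖r‖ ≤ δ⁻¹)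
    (hl : r * S.ofKern (hopKern step V) = 1) (hr' : S.ofKern (hopKern step V) * r = 1)
    (n : Fin d → ℤ) (ω : Ω) :
    ‖S.kernel r n ω‖ ≤ Real.exp (-ξ * latticeNorm n) / (δ - 2 * d * Real.sinh ξ) := by
  have hL := latticeNorm_nonneg n
  have hδ : 0 < δ := lt_of_le_of_lt (by have := Real.sinh_nonneg_iff.2 hξ; positivity) hδξ
  set L := latticeNorm n with hLdef
  -- A linear slope towards `n` makes opposite steps have opposite increments; the clamp to [0, L]
  -- keeps the weight bounded, so that the weighted vector stays in ℓ².
  set w : (Fin d → ℤ) → ℝ := fun m => max 0 (min (slope n m) L) with hw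
  have hw1 : ∀ m, w m ≤ L := fun m => max_le hL (min_le_right _ _)
  have hw0 : ∀ m, 0 ≤ w m := fun m => le_max_left _ _
  -- Normalized to be 1 at the source `n` and e^(ξL) at the origin, where the decay is read off.
  set D : (Fin d → ℤ) → ℝ := fun m => Real.exp (ξ * (L - w m)) with hDdef
  have hD1 : ∀ m, ‖(D m : ℂ)‖ ≤ Real.exp (ξ * L) := fun m => by
    rw [Complex.norm_real, Real.norm_of_nonneg (Real.exp_nonneg _), Real.exp_le_exp]
    exact mul_le_mul_of_nonneg_left (by linarith [hw0 m]) hξ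
  have hwn : w n = L := by simp [hw, slope_self, ← hLdef, hL]
  have hw00 : w 0 = 0 := by simp [hw, slope, hL]
  set A := S.rep (hopKern step V) ω with hA
  set Ψ : L2 (Fin d → ℤ) := (r : Fam _ Ω) ω (ket n) with hΨ
  have hAΨ : A Ψ = ket n := by
    change ((S.ofKern (hopKern step V) * r : S.Alg) : Fam _ Ω) ω (ket n) = ket n
    rw [hr']
    rfl
  set φ : L2 (Fin d → ℤ) := hop 0 (fun m => (D m : ℂ)) _ hD1 Ψ with hφ
  have hφm : ∀ m, φ m = D m * Ψ m := fun m => by rw [hφ, hop_apply, add_zero]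
  set c : Fin d × Bool → ℝ := fun i =>
    |1 - Real.exp (ξ * ((if i.2 then 1 else -1) * (n i.1 / L)))| with hc
  have hcsum : ∑ i, c i ≤ 2 * d * Real.sinh ξ := by
    rw [Fintype.sum_prod_type]
    simp only [Fintype.sum_bool, hc, if_true, Bool.false_eq_true, if_false]
    have : ∀ j : Fin d, |1 - Real.exp (ξ * (1 * ((n j : ℝ) / L)))|
        + |1 - Real.exp (ξ * (-1 * ((n j : ℝ) / L)))| ≤ 2 * Real.sinh ξ := fun j => by
      rw [one_mul, neg_one_mul, mul_neg]
      refine abs_one_sub_exp_add_le ?_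
      rw [abs_mul, abs_of_nonneg hξ]
      exact mul_le_of_le_one_right hξ (abs_div_latticeNorm_le n j)
    refine (Finset.sum_le_sum fun j _ => this j).trans (le_of_eq ?_)
    rw [Finset.sum_const, Finset.card_univ, Fintype.card_fin, nsmul_eq_mul]
    ring
  have hcD : ∀ i m, |1 - D m / D (m + step i)| ≤ c i := fun i m => by
    have e : D m / D (m + step i) = Real.exp (ξ * (w (m + step i) - w m)) := by
      rw [hDdef, ← Real.exp_sub]
      congr 1
      ring
    rw [e]
    refine abs_one_sub_exp_le ?_
    have h := clamp_add_sub hL (slope n m) (slope n (step i))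
    rw [← slope_add] at h
    obtain ⟨j, b⟩ := i
    rw [← slope_step]
    rcases h with h | h
    · exact Or.inl ⟨mul_nonneg hξ h.1, mul_le_mul_of_nonneg_left h.2 hξ⟩
    · exact Or.inr ⟨mul_le_mul_of_nonneg_left h.1 hξ, mul_nonpos_of_nonneg_of_nonpos hξ h.2⟩
  -- Since `D n = 1`, the weighted right-hand side is still the unit vector at `n`.
  have hmain := S.norm_rep_hopKern_sub_le step V ω D (fun m => Real.exp_pos _) c hcD φ (ket n) Ψ
    hφm fun m => by
      rw [← S.rep_hopKern, ← hA, hAΨ, ket_apply]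
      split_ifs with h
      · subst h; simp [hDdef, hwn]
      · simp
  have hlow := norm_le_of_left_inverse S _ r δ hδ hr hl ω φ
  change δ * ‖φ‖ ≤ ‖A φ‖ at hlow
  have hup : ‖A φ‖ ≤ 2 * d * Real.sinh ξ * ‖φ‖ + 1 := by
    have h1 := norm_sub_norm_le (A φ) (ket n)
    rw [norm_ket] at h1
    have h2 := mul_le_mul_of_nonneg_right hcsum (norm_nonneg φ)
    linarith
  have hφle : ‖φ‖ ≤ 1 / (δ - 2 * d * Real.sinh ξ) := by
    rw [le_div_iff₀ (by linarith)]
    linarith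
  -- The entry of `φ` at the origin is e^(ξL) times the kernel of `r` at `n`.
  have h0 := (lp.norm_apply_le_norm (p := 2) (by norm_num) φ 0).trans hφle
  rw [hφm, norm_mul, Complex.norm_real, Real.norm_of_nonneg (Real.exp_nonneg _), hw00,
    sub_zero] at h0
  change ‖Ψ 0‖ ≤ _
  calc ‖Ψ 0‖ = Real.exp (-ξ * L) * (Real.exp (ξ * L) * ‖Ψ 0‖) := by
        rw [← mul_assoc, ← Real.exp_add]; simp
    _ ≤ Real.exp (-ξ * L) * (1 / (δ - 2 * d * Real.sinh ξ)) :=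
        mul_le_mul_of_nonneg_left h0 (Real.exp_nonneg _)
    _ = _ := by rw [mul_one_div]

end Decay

/-! ### Passing from the torus to the lattice -/

/-- The class of a lattice point in the torus. -/
def toTorus {d : ℕ} (N : ℕ) (n : Fin d → ℤ) : Torus d N := fun i => (n i : ZMod (2 * N + 1))

theorem toTorus_add {d N : ℕ} (m n : Fin d → ℤ) :
    toTorus N (m + n) = toTorus N m + toTorus N n := by
  funext i
  simp [toTorus]

theorem toTorus_neg {d N : ℕ} (n : Fin d → ℤ) : toTorus N (-n) = -toTorus N n := by
  funext i
  simp [toTorus]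

theorem toTorus_zero {d N : ℕ} : toTorus N (0 : Fin d → ℤ) = 0 := by
  funext i
  simp [toTorus]

theorem toTorus_coord {d N : ℕ} (p : Torus d N) : toTorus N (coord p) = p := by
  funext i
  simp [toTorus, coord]

theorem coord_injective {d N : ℕ} : Function.Injective (coord : Torus d N → Fin d → ℤ) :=
  Function.LeftInverse.injective toTorus_coord

theorem abs_coord_le {d N : ℕ} (p : Torus d N) (i : Fin d) : |coord p i| ≤ N := by
  have h := ZMod.valMinAbs_mem_Ioc (p i)
  rw [Set.mem_Ioc] at h
  push_cast at h
  rw [coord, abs_le]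
  omega

theorem coord_toTorus {d N : ℕ} {n : Fin d → ℤ} (h : ∀ i, |n i| ≤ N) :
    coord (toTorus N n) = n := by
  funext i
  have h := abs_le.1 (h i)
  refine (ZMod.valMinAbs_spec _ _).2 ⟨rfl, ?_⟩
  rw [Set.mem_Ioc]
  push_cast
  omega

theorem coord_zero {d N : ℕ} : coord (0 : Torus d N) = 0 := by
  funext i
  simp [coord]

theorem coord_eq_iff {d N : ℕ} {p : Torus d N} {n : Fin d → ℤ} (h : ∀ i, |n i| ≤ N) :
    coord p = n ↔ p = toTorus N n := by
  rw [← coord_injective.eq_iff, coord_toTorus h]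

theorem abs_step_le {d N : ℕ} (hN : 1 ≤ N) (i : Fin d × Bool) (k : Fin d) :
    |step i k| ≤ N := by
  obtain ⟨j, b⟩ := i
  by_cases h : k = j
  · subst h
    cases b <;> simpa [step] using hN
  · simp [step, h]

theorem exists_coord_toTorus {d N : ℕ} (n : Fin d → ℤ) :
    ∃ s : Fin d → ℤ, n = coord (toTorus N n) + fun i => (2 * (N : ℤ) + 1) * s i := by
  have h : ∀ i, ∃ s : ℤ, n i = coord (toTorus N n) i + (2 * (N : ℤ) + 1) * s := by
    intro i
    have h0 : ((n i - coord (toTorus N n) i : ℤ) : ZMod (2 * N + 1)) = 0 := by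
      simp [coord, toTorus]
    obtain ⟨s, hs⟩ := (ZMod.intCast_zmod_eq_zero_iff_dvd _ _).1 h0
    refine ⟨s, ?_⟩
    push_cast at hs
    linarith
  choose s hs using h
  exact ⟨s, funext hs⟩

/-- The step `±e_j` on the torus. -/
def torStep {d : ℕ} (N : ℕ) (i : Fin d × Bool) : Torus d N := toTorus N (step i)

theorem unroll_apply {d N : ℕ} (ω : OmegaTor d N) (n : Fin d → ℤ) :
    (unroll ω).1 n = ω (toTorus N n) := rfl

theorem rollUp_apply {d N : ℕ} (ω : OmegaPer d N) (p : Torus d N) :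
    rollUp ω p = ω.1 (coord p) := rfl

section Bridge

variable {d : ℕ} (N : ℕ) (F : Matrix (Fin d) (Fin d) ℝ) (hF : F.transpose = -F)
  (hQ : ∀ i j, ∃ k : ℤ, F i j = 2 / (2 * N + 1) * k)

include hQ in
-- A lattice point differs from its representative in the cell by a period, on which the quantized
-- flux has trivial phase.
theorem magPhase_coord_left (m n : Fin d → ℤ) :
    magPhase F (coord (toTorus N m)) n = magPhase F m n := by
  obtain ⟨s, hs⟩ := exists_coord_toTorus (N := N) m
  conv_rhs => rw [hs, magPhase_add_left, magPhase_period F hQ, mul_one]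

include hF hQ in
theorem magPhase_coord (m n : Fin d → ℤ) :
    magPhase F (coord (toTorus N m)) (coord (toTorus N n)) = magPhase F m n := by
  rw [magPhase_coord_left N F hQ, magPhase_swap F hF (coord (toTorus N n)),
    magPhase_coord_left N F hQ, magPhase_swap F hF m, inv_inv]

theorem torSystem_phase (m n : Fin d → ℤ) :
    (torSystem N F hF hQ).phase (toTorus N m) (toTorus N n) = (perSystem N F hF).phase m n :=
  magPhase_coord N F hF hQ m n

theorem perSystem_shift_unroll (m : Fin d → ℤ) (ω : OmegaTor d N) :
    (perSystem N F hF).shift m (unroll ω)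
      = unroll ((torSystem N F hF hQ).shift (toTorus N m) ω) := by
  refine Subtype.ext (funext fun n => ?_)
  change ω (toTorus N (n + m)) = ω (toTorus N n + toTorus N m)
  rw [toTorus_add]

/-! ### The two Hamiltonians as nearest-neighbour operators -/

/-- The potential `W ω_0`. -/
def torPotential (d N : ℕ) (W : ℝ) : C(OmegaTor d N, ℂ) :=
  ⟨fun ω => (W : ℂ) * ((ω 0 : ℝ) : ℂ), by fun_prop⟩

/-- The potential `W ω_0`. -/
def perPotential (d N : ℕ) (W : ℝ) : C(OmegaPer d N, ℂ) :=
  ⟨fun ω => (W : ℂ) * ((ω.1 0 : ℝ) : ℂ),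
    continuous_const.mul (Complex.continuous_ofReal.comp (continuous_subtype_val.comp
      ((continuous_apply 0).comp continuous_subtype_val)))⟩

/-- As N ≥ 1, the neighbours of the origin lie in the cell, so restriction to the cell loses no
hopping term. -/
theorem torHamiltonian_eq (hN : 1 ≤ N) (W : ℝ) :
    torHamiltonian N W F hF hQ
      = (torSystem N F hF hQ).ofKern (hopKern (torStep N) (torPotential d N W)) := by
  rw [torHamiltonian, mapP]
  refine congrArg (torSystem N F hF hQ).ofKern
    (Finsupp.ext fun p => ContinuousMap.ext fun ω => ?_)
  rw [hopKern_apply]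
  change (perSystem N F hF).kernel _ (coord p) (unroll ω) = _
  rw [MagneticSystem.kernel_ofKern]
  change (if latticeNorm (coord p) = 1 then (1 : ℂ) else 0)
      + (W : ℂ) * (((unroll ω).1 (coord p) : ℝ) : ℂ) * (if coord p = 0 then 1 else 0) = _
  rw [ite_latticeNorm, add_comm]
  have h0 : coord p = 0 ↔ p = 0 := by rw [← coord_injective.eq_iff, coord_zero]
  congr 1
  · by_cases h : p = 0
    · rw [if_pos h, if_pos (h0.2 h), mul_one, unroll_apply, toTorus_coord, h]
      rfl
    · rw [if_neg h, if_neg (mt h0.1 h), mul_zero]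
  · refine Finset.sum_congr rfl fun i _ => ?_
    simp only [coord_eq_iff (abs_step_le hN i)]
    rfl

theorem perHamiltonian_eq (hN : 1 ≤ N) (W : ℝ) :
    perHamiltonian N W F hF hQ
      = (perSystem N F hF).ofKern (hopKern step (perPotential d N W)) := by
  rw [perHamiltonian, torHamiltonian_eq N F hF hQ hN, mapJ]
  refine congrArg (perSystem N F hF).ofKern
    (Finsupp.ext fun n => ContinuousMap.ext fun ω => ?_)
  rw [hopKern_apply, Finsupp.finsetSum_apply, ContinuousMap.sum_apply]
  simp only [MagneticSystem.kernel_ofKern, Finsupp.single_apply]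
  have e : ∀ q : Torus d N, (if coord q = n then
      ((hopKern (torStep N) (torPotential d N W)) q).comp rollUp else 0) ω
      = if coord q = n then hopKern (torStep N) (torPotential d N W) q (rollUp ω) else 0 :=
    fun q => by split_ifs <;> rfl
  simp only [e, hopKern_apply]
  by_cases hn : ∀ i, |n i| ≤ N
  · rw [Finset.sum_eq_single (toTorus N n)]
    · rw [if_pos (coord_toTorus hn)]
      congr 1
      · have h0 : toTorus N n = 0 ↔ n = 0 := by
          rw [eq_comm, ← coord_eq_iff hn, coord_zero, eq_comm]
        simp only [h0]
        by_cases h : n = 0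
        · rw [if_pos h, if_pos h]
          change (W : ℂ) * ((rollUp ω 0 : ℝ) : ℂ) = _
          rw [rollUp_apply, coord_zero]
          rfl
        · rw [if_neg h, if_neg h]
      · refine Finset.sum_congr rfl fun i _ => ?_
        have : toTorus N n = torStep N i ↔ n = step i := by
          rw [torStep, ← coord_eq_iff (abs_step_le hN i), coord_toTorus hn]
        simp only [this]
    · intro q _ hq
      exact if_neg fun h => hq ((coord_eq_iff hn).1 h)
    · simp
  -- Outside the cell both sides vanish: the left by construction of J, the right because 0 and the
  -- steps lie inside.
  · rw [Finset.sum_eq_zero, if_neg, Finset.sum_eq_zero, add_zero]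
    · rintro i -
      refine if_neg ?_
      rintro rfl
      exact hn (abs_step_le hN i)
    · rintro rfl
      exact hn fun i => by simp
    · rintro q -
      refine if_neg ?_
      rintro rfl
      exact hn (abs_coord_le q)

theorem isSelfAdjoint_torHamiltonian (hN : 1 ≤ N) (W : ℝ) :
    IsSelfAdjoint (torHamiltonian N W F hF hQ) := by
  rw [torHamiltonian_eq N F hF hQ hN]
  refine MagneticSystem.isSelfAdjoint_hopKern _ _ _ (reverseStep d) (fun i => ?_) fun ω => ?_
  · rw [torStep, torStep, step_reverseStep, toTorus_neg]
  · change (starRingEnd ℂ) ((W : ℂ) * ((ω 0 : ℝ) : ℂ)) = (W : ℂ) * ((ω 0 : ℝ) : ℂ)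
    simp

theorem isSelfAdjoint_perHamiltonian (hN : 1 ≤ N) (W : ℝ) :
    IsSelfAdjoint (perHamiltonian N W F hF hQ) := by
  rw [perHamiltonian_eq N F hF hQ hN]
  refine MagneticSystem.isSelfAdjoint_hopKern _ _ _ (reverseStep d) step_reverseStep fun ω => ?_
  change (starRingEnd ℂ) ((W : ℂ) * ((ω.1 0 : ℝ) : ℂ)) = (W : ℂ) * ((ω.1 0 : ℝ) : ℂ)
  simp

end Bridge

/-! ### The spectrum of the torus Hamiltonian -/

theorem res_mul_cancel {A : Type} [Ring A] [Algebra ℂ A] {a : A} {z : ℂ}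
    (hz : z ∉ spectrum ℂ a) : res a z * (a - algebraMap ℂ A z) = 1 :=
  Ring.inverse_mul_cancel _ (isUnit_sub_algebraMap hz)

theorem mul_res_cancel {A : Type} [Ring A] [Algebra ℂ A] {a : A} {z : ℂ}
    (hz : z ∉ spectrum ℂ a) : (a - algebraMap ℂ A z) * res a z = 1 :=
  Ring.mul_inverse_cancel _ (isUnit_sub_algebraMap hz)

theorem nontrivial_alg {G Ω : Type} [AddCommGroup G] [TopologicalSpace Ω] [CompactSpace Ω]
    [Nonempty Ω] (S : MagneticSystem G Ω) : Nontrivial S.Alg := by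
  classical
  refine ⟨⟨1, 0, fun h => ?_⟩⟩
  have h1 := S.kernel_one 0 (Classical.arbitrary Ω)
  rw [h, if_pos rfl] at h1
  exact zero_ne_one h1

instance instNonemptyOmegaTor {d N : ℕ} : Nonempty (OmegaTor d N) :=
  ⟨fun _ => ⟨0, by norm_num, by norm_num⟩⟩

instance instNonemptyOmegaPer {d N : ℕ} : Nonempty (OmegaPer d N) :=
  instNonemptyOmegaTor.map (unroll (d := d) (N := N))

/-- In finite dimension injectivity suffices and the inverse is automatically continuous. Excluding
eigenvalues therefore excludes spectrum in each fibre over the torus. -/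
theorem exists_op_inverse {G : Type} [Fintype G] (A : Op G) (h : ∀ φ, A φ = 0 → φ = 0) :
    IsUnit A := by
  have : FiniteDimensional ℂ (L2 G) :=
    (lpPiLpₗᵢ (fun _ : G => ℂ) ℂ (p := 2)).symm.toLinearEquiv.finiteDimensional
  have hinj : Function.Injective (A : L2 G →ₗ[ℂ] L2 G) :=
    (injective_iff_map_eq_zero (A : L2 G →ₗ[ℂ] L2 G)).2 h
  let E := (LinearEquiv.ofInjectiveEndo (A : L2 G →ₗ[ℂ] L2 G) hinj).toContinuousLinearEquiv
  have hE : ∀ φ, E φ = A φ := fun φ => rfl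
  refine ⟨⟨A, E.symm, ?_, ?_⟩, rfl⟩
  · ext1 φ
    change A (E.symm φ) = φ
    rw [← hE, E.apply_symm_apply]
  · ext1 φ
    change E.symm (A φ) = φ
    rw [← hE, E.symm_apply_apply]

theorem memlp_of_norm_le_of_summable {G : Type} (φ : G → ℂ) (u : G → ℝ)
    (hu : Summable u) (h : ∀ n, ‖φ n‖ ^ 2 ≤ u n) : Memℓp φ 2 := by
  refine memℓp_gen (Summable.of_nonneg_of_le (fun n => by positivity) (fun n => ?_) hu)
  simpa using h n

section Bridge

variable {d : ℕ} (N : ℕ) (F : Matrix (Fin d) (Fin d) ℝ) (hF : F.transpose = -F)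
  (hQ : ∀ i j, ∃ k : ℤ, F i j = 2 / (2 * N + 1) * k)

theorem isClosed_perSpectrum (W : ℝ) : IsClosed (perSpectrum N W F hF hQ) :=
  spectrum.isClosed _

theorem isCompact_perSpectrum (W : ℝ) : IsCompact (perSpectrum N W F hF hQ) :=
  spectrum.isCompact _

theorem perSpectrum_nonempty (W : ℝ) : (perSpectrum N W F hF hQ).Nonempty := by
  have := nontrivial_alg (perSystem N F hF)
  exact spectrum.nonempty _

theorem torSpectrum_nonempty (W : ℝ) : (torSpectrum N W F hF hQ).Nonempty := by
  have := nontrivial_alg (torSystem N F hF hQ)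
  exact spectrum.nonempty _

theorem infDist_perSpectrum_pos {W : ℝ} {z : ℂ} (hz : z ∉ perSpectrum N W F hF hQ) :
    0 < Metric.infDist z (perSpectrum N W F hF hQ) :=
  ((isClosed_perSpectrum N F hF hQ W).notMem_iff_infDist_pos
    (perSpectrum_nonempty N F hF hQ W)).1 hz

theorem norm_res_perHamiltonian_le (hN : 1 ≤ N) {W : ℝ} {z : ℂ}
    (hz : z ∉ perSpectrum N W F hF hQ) :
    ‖res (perHamiltonian N W F hF hQ) z‖ ≤ (Metric.infDist z (perSpectrum N W F hF hQ))⁻¹ := by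
  have := nontrivial_alg (perSystem N F hF)
  exact norm_res_le (isSelfAdjoint_perHamiltonian N F hF hQ hN W) hz

theorem perHamiltonian_sub (hN : 1 ≤ N) (W : ℝ) (z : ℂ) :
    perHamiltonian N W F hF hQ - algebraMap ℂ _ z = (perSystem N F hF).ofKern
      (hopKern step (perPotential d N W - ContinuousMap.const _ z)) := by
  rw [perHamiltonian_eq N F hF hQ hN, MagneticSystem.ofKern_hopKern_sub]

theorem torHamiltonian_sub (hN : 1 ≤ N) (W : ℝ) (z : ℂ) :
    torHamiltonian N W F hF hQ - algebraMap ℂ _ z = (torSystem N F hF hQ).ofKern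
      (hopKern (torStep N) (torPotential d N W - ContinuousMap.const _ z)) := by
  rw [torHamiltonian_eq N F hF hQ hN, MagneticSystem.ofKern_hopKern_sub]

theorem exists_pos_mul_exp_sub_one_lt (c : ℝ) {δ : ℝ} (hδ : 0 < δ) :
    ∃ ε > 0, c * (Real.exp ε - 1) < δ := by
  have h : Filter.Tendsto (fun ε : ℝ => c * (Real.exp ε - 1)) (nhds 0) (nhds 0) := by
    have : Continuous fun ε : ℝ => c * (Real.exp ε - 1) := by fun_prop
    simpa using this.tendsto 0
  have h1 := (h.eventually (gt_mem_nhds hδ)).filter_mono (nhdsWithin_le_nhds (s := Set.Ioi 0))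
  obtain ⟨ε, h2, h3⟩ := (h1.and self_mem_nhdsWithin).exists
  exact ⟨ε, h3, h2⟩

/-- A point outside of the spectrum in the periodic algebra is not an eigenvalue on the torus. -/
theorem eq_zero_of_rep_torus_eq_zero (hN : 1 ≤ N) {W : ℝ} {z : ℂ}
    (hz : z ∉ perSpectrum N W F hF hQ) (ω : OmegaTor d N) (ψ : L2 (Torus d N))
    (hψ : (torSystem N F hF hQ).rep
      (hopKern (torStep N) (torPotential d N W - ContinuousMap.const _ z)) ω ψ = 0) : ψ = 0 := by
  have hδ := infDist_perSpectrum_pos N F hF hQ hz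
  set δ := Metric.infDist z (perSpectrum N W F hF hQ)
  -- There are 2d steps, and damping at rate ε costs at most e^ε - 1 for each.
  obtain ⟨ε, hε, hεδ⟩ := exists_pos_mul_exp_sub_one_lt (2 * d) hδ
  set D : (Fin d → ℤ) → ℝ := fun n => Real.exp (-ε * latticeNorm n) with hD
  -- As 0 < D ≤ 1, the square of the damped function is at most D ‖ψ‖², which is summable.
  have hmem : Memℓp (fun n : Fin d → ℤ => (D n : ℂ) * ψ (toTorus N n)) 2 := by
    refine memlp_of_norm_le_of_summable _ (fun n => D n * ‖ψ‖ ^ 2)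
      ((summable_exp_neg_latticeNorm d hε).mul_right _) fun n => ?_
    have h1 : D n ≤ 1 := Real.exp_le_one_iff.2 (by
      have := mul_nonneg hε.le (latticeNorm_nonneg n); linarith)
    have h2 := lp.norm_apply_le_norm (p := 2) (by norm_num) ψ (toTorus N n)
    have h3 : 0 ≤ D n := Real.exp_nonneg _
    rw [norm_mul, Complex.norm_real, Real.norm_of_nonneg h3, mul_pow]
    refine mul_le_mul ?_ (pow_le_pow_left₀ (norm_nonneg _) h2 2) (by positivity) h3
    nlinarith
  set φ : L2 (Fin d → ℤ) := ⟨_, hmem⟩ with hφ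
  have hφn : ∀ n, φ n = D n * ψ (toTorus N n) := fun n => rfl
  have hDD : ∀ (i : Fin d × Bool) n, |1 - D n / D (n + step i)| ≤ Real.exp ε - 1 := by
    intro i n
    have e : D n / D (n + step i)
        = Real.exp (ε * (latticeNorm (n + step i) - latticeNorm n)) := by
      rw [hD, ← Real.exp_sub]
      congr 1
      ring
    have h1 := latticeNorm_add_le n (step i)
    have h2 := latticeNorm_add_le (n + step i) (-step i)
    rw [add_neg_cancel_right, ← step_reverseStep, latticeNorm_step] at h2
    rw [latticeNorm_step] at h1
    rw [e, abs_le]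
    have h3 := Real.exp_le_exp.2 (show ε * (latticeNorm (n + step i) - latticeNorm n) ≤ ε by
      nlinarith)
    have h4 := Real.exp_le_exp.2 (show -ε ≤ ε * (latticeNorm (n + step i) - latticeNorm n) by
      nlinarith)
    have h5 := Real.add_one_le_exp ε
    have h6 : Real.exp (-ε) * Real.exp ε = 1 := by rw [← Real.exp_add]; simp
    have h7 := Real.exp_pos (-ε)
    -- The bound from below uses 1 - e^(-ε) ≤ e^ε - 1, that is (e^ε - 1)² ≥ 0.
    constructor <;> nlinarith [sq_nonneg (Real.exp ε - 1)]
  -- The unrolled ψ solves the same equation on ℤ^d over the unrolled configuration, so the target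
  -- vector is 0 and only the damping error remains.
  have h1 := (perSystem N F hF).norm_rep_hopKern_sub_le step
    (perPotential d N W - ContinuousMap.const _ z) (unroll ω) D (fun n => Real.exp_pos _)
    (fun _ => Real.exp ε - 1) hDD φ 0 (fun n => ψ (toTorus N n)) hφn fun n => by
      have h2 := congrArg (fun χ : L2 (Torus d N) => χ (toTorus N n)) hψ
      simp only [MagneticSystem.rep_hopKern, lp.coeFn_zero, Pi.zero_apply] at h2
      simp only [lp.coeFn_zero, Pi.zero_apply]
      rw [eq_comm, mul_eq_zero]
      right
      rw [← h2, perSystem_shift_unroll N F hF hQ, toTorus_neg]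
      congr 1
      refine Finset.sum_congr rfl fun i _ => ?_
      rw [torStep, ← toTorus_add, torSystem_phase]
  have h2 := norm_le_of_left_inverse (perSystem N F hF) _ _ _ hδ
    (norm_res_perHamiltonian_le N F hF hQ hN hz) (res_mul_cancel hz) (unroll ω) φ
  rw [perHamiltonian_sub N F hF hQ hN] at h2
  change δ * ‖φ‖ ≤ ‖(perSystem N F hF).rep _ (unroll ω) φ‖ at h2
  rw [sub_zero] at h1
  simp only [Finset.sum_const, Finset.card_univ, Fintype.card_prod, Fintype.card_fin,
    Fintype.card_bool, nsmul_eq_mul] at h1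
  push_cast at h1
  have h3 : φ = 0 := by
    rw [← norm_eq_zero]
    nlinarith [norm_nonneg φ]
  -- The damping factor never vanishes, so φ = 0 forces ψ = 0 at every point of the torus.
  ext p
  have h4 := hφn (coord p)
  rw [h3, toTorus_coord] at h4
  have h5 : (D (coord p) : ℂ) ≠ 0 := by exact_mod_cast (Real.exp_pos _).ne'
  simpa [h5] using h4.symm

/-- Each fibre has its spectrum inside the periodic one, which bounds the fibre resolvents uniformly
in the configuration. They then form a bounded family inverting T - z. -/
theorem torSpectrum_subset (hN : 1 ≤ N) (W : ℝ) :
    torSpectrum N W F hF hQ ⊆ perSpectrum N W F hF hQ := by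
  intro z hz
  by_contra hzp
  set S := torSystem N F hF hQ
  set a := torHamiltonian N W F hF hQ with ha
  have hsa := isSelfAdjoint_torHamiltonian N F hF hQ hN W
  set A : OmegaTor d N → Op (Torus d N) := fun ω => (a : Fam (Torus d N) (OmegaTor d N)) ω with hA
  have hAsa : ∀ ω, IsSelfAdjoint (A ω) := fun ω =>
    congrArg (fun b : S.Alg => (b : Fam (Torus d N) (OmegaTor d N)) ω) hsa
  have hspec : ∀ ω, spectrum ℂ (A ω) ⊆ perSpectrum N W F hF hQ := by
    intro ω w hw
    by_contra hwp
    refine spectrum.notMem_iff.2 ?_ hw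
    rw [← IsUnit.neg_iff, neg_sub]
    refine exists_op_inverse _ fun φ hφ => ?_
    refine eq_zero_of_rep_torus_eq_zero N F hF hQ hN hwp ω φ ?_
    rw [← hφ]
    have := congrArg (fun b : S.Alg => (b : Fam (Torus d N) (OmegaTor d N)) ω φ)
      (torHamiltonian_sub N F hF hQ hN W w)
    exact this.symm
  have hδ := infDist_perSpectrum_pos N F hF hQ hzp
  have hbound : ∀ ω, ‖res (A ω) z‖ ≤ (Metric.infDist z (perSpectrum N W F hF hQ))⁻¹ := by
    intro ω
    refine (norm_res_le (hAsa ω) fun h => hzp (hspec ω h)).trans (inv_anti₀ hδ ?_)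
    exact Metric.infDist_le_infDist_of_subset (hspec ω) (spectrum.nonempty _)
  let r : Fam (Torus d N) (OmegaTor d N) := ⟨fun ω => res (A ω) z, memℓp_infty ⟨_, by
    rintro _ ⟨ω, rfl⟩
    exact hbound ω⟩⟩
  have hu : IsUnit ((a - algebraMap ℂ S.Alg z : S.Alg) : Fam (Torus d N) (OmegaTor d N)) := by
    refine ⟨⟨_, r, ?_, ?_⟩, rfl⟩
    · exact lp.ext (funext fun ω => mul_res_cancel fun h => hzp (hspec ω h))
    · exact lp.ext (funext fun ω => res_mul_cancel fun h => hzp (hspec ω h))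
  have := S.core.isClosed_topologicalClosure
  -- Spectral permanence: the inverse found among all bounded families already lies in the
  -- C*-subalgebra.
  have hu' := (StarSubalgebra.coe_isUnit S.core.topologicalClosure).1 hu
  refine spectrum.notMem_iff.2 ?_ hz
  rw [← IsUnit.neg_iff, neg_sub]
  exact hu'

end Bridge

/-! ### The comparison of the resolvents -/

/-- The step `±e_j` leaves the cell `{-N, …, N}^d` only through the face `n_j = ±N`. -/
theorem coord_sub_torStep {d N : ℕ} (p : Torus d N) (i : Fin d × Bool)
    (h : coord p i.1 ≠ -(N : ℤ) * step i i.1) :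
    coord (p - torStep N i) = coord p - step i := by
  have e : p - torStep N i = toTorus N (coord p - step i) := by
    rw [sub_eq_add_neg, sub_eq_add_neg, toTorus_add, toTorus_neg, toTorus_coord, torStep]
  rw [e]
  refine coord_toTorus fun k => ?_
  have h1 := abs_le.1 (abs_coord_le p k)
  obtain ⟨j, b⟩ := i
  by_cases hk : k = j
  · subst hk
    rw [Pi.sub_apply, abs_le]
    cases b <;> simp [step] at h ⊢ <;> omega
  · rw [Pi.sub_apply, abs_le]
    simpa [step, hk] using h1

/-- A step out through a face re-enters at the opposite one: the displacement by minus a step is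
corrected by the period 2N + 1 and becomes 2N steps. -/
theorem coord_sub_torStep_face {d N : ℕ} (p : Torus d N) (i : Fin d × Bool)
    (h : coord p i.1 = -(N : ℤ) * step i i.1) :
    coord (p - torStep N i) = coord p + fun k => 2 * (N : ℤ) * step i k := by
  have e : p - torStep N i = toTorus N (coord p + fun k => 2 * (N : ℤ) * step i k) := by
    rw [toTorus_add, toTorus_coord, sub_eq_add_neg]
    congr 1
    funext k
    have h0 : (2 * (N : ZMod (2 * N + 1)) + 1) = 0 := by
      exact_mod_cast ZMod.natCast_self (2 * N + 1)
    simp only [torStep, toTorus, Pi.neg_apply]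
    push_cast
    linear_combination (-(step i k : ZMod (2 * N + 1))) * h0
  rw [e]
  refine coord_toTorus fun k => ?_
  have h1 := abs_le.1 (abs_coord_le p k)
  obtain ⟨j, b⟩ := i
  by_cases hk : k = j
  · subst hk
    rw [Pi.add_apply, abs_le]
    cases b <;> simp [step] at h ⊢ <;> omega
  · rw [Pi.add_apply, abs_le]
    simpa [step, hk] using h1

theorem removeNth_add_step {d : ℕ} (n : Fin (d + 1) → ℤ) (a : ℤ) (i : Fin (d + 1) × Bool) :
    i.1.removeNth (n + fun k => a * step i k) = i.1.removeNth n := by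
  funext k
  simp [Fin.removeNth, step]

/-- The large coordinate gives the factor e^(-ξN/√2); the other coordinates keep a decay that is
summable along the face. -/
theorem exp_neg_latticeNorm_le {d N : ℕ} {ξ : ℝ} (hξ : 0 ≤ ξ) (j : Fin (d + 1))
    (n : Fin (d + 1) → ℤ) (h : (N : ℤ) ≤ |n j|) :
    Real.exp (-ξ * latticeNorm n)
      ≤ Real.exp (-(ξ / √2) * N) * Real.exp (-(ξ / √2) * latticeNorm (j.removeNth n)) := by
  rw [← Real.exp_add, Real.exp_le_exp]
  have h1 : (N : ℝ) ≤ |(n j : ℝ)| := by exact_mod_cast h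
  have h2 := mul_le_mul_of_nonneg_left (le_latticeNorm_removeNth j n) hξ
  have h3 : ξ / √2 * N ≤ ξ / √2 * |(n j : ℝ)| := mul_le_mul_of_nonneg_left h1 (by positivity)
  have h4 : ξ * ((|(n j : ℝ)| + latticeNorm (j.removeNth n)) / √2)
      = ξ / √2 * |(n j : ℝ)| + ξ / √2 * latticeNorm (j.removeNth n) := by ring
  linarith

/-- The sum over a face of the cell is bounded by the sum over the lattice of one dimension
less. -/
theorem sum_face_le {d N : ℕ} {η : ℝ} (hη : 0 < η) (j : Fin (d + 1)) (a : ℤ) :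
    ∑ p : Torus (d + 1) N,
        (if coord p j = a then Real.exp (-η * latticeNorm (j.removeNth (coord p))) else 0)
      ≤ latticeSum d η := by
  rw [← Finset.sum_filter]
  -- With one coordinate fixed, the point is determined by the others.
  have hinj : Set.InjOn (fun p : Torus (d + 1) N => j.removeNth (coord p))
      ↑(Finset.univ.filter fun p : Torus (d + 1) N => coord p j = a) := by
    intro p hp q hq h
    have hp' : coord p j = a := by simpa using hp
    have hq' : coord q j = a := by simpa using hq
    refine coord_injective ?_
    rw [← Fin.insertNth_self_removeNth j (coord p), ← Fin.insertNth_self_removeNth j (coord q),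
      hp', hq', show j.removeNth (coord p) = j.removeNth (coord q) from h]
  rw [← Finset.sum_image (f := fun γ => Real.exp (-η * latticeNorm γ)) hinj]
  exact (summable_exp_neg_latticeNorm d hη).sum_le_tsum _ fun _ _ => Real.exp_nonneg _

section Bridge

variable {d : ℕ} (N : ℕ) (F : Matrix (Fin d) (Fin d) ℝ) (hF : F.transpose = -F)
  (hQ : ∀ i j, ∃ k : ℤ, F i j = 2 / (2 * N + 1) * k)

theorem kernel_mapP (f : (perSystem N F hF).Alg) (p : Torus d N) (ω : OmegaTor d N) :
    (torSystem N F hF hQ).kernel (mapP N F hF hQ f) p ω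
      = (perSystem N F hF).kernel f (coord p) (unroll ω) := by
  rw [mapP, MagneticSystem.kernel_ofKern]
  rfl

/-- The cardinality factor is crude and harmless: only the continuity of P is needed, to exchange it
with integrals. -/
theorem norm_mapP_le (f : (perSystem N F hF).Alg) :
    ‖mapP N F hF hQ f‖ ≤ Fintype.card (Torus d N) * ‖f‖ := by
  refine ((torSystem N F hF hQ).norm_le_sum_kernel _).trans ?_
  rw [← nsmul_eq_mul, ← Finset.card_univ, ← Finset.sum_const]
  refine Finset.sum_le_sum fun p _ => (ContinuousMap.norm_le _ (norm_nonneg _)).2 fun ω => ?_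
  rw [kernel_mapP]
  exact (ContinuousMap.norm_coe_le_norm _ _).trans ((perSystem N F hF).norm_kernel_le f _)

/-- `P` as a bounded linear map. -/
noncomputable def mapPL : (perSystem N F hF).Alg →L[ℂ] (torSystem N F hF hQ).Alg :=
  LinearMap.mkContinuous
    { toFun := mapP N F hF hQ
      map_add' := fun f g => MagneticSystem.alg_ext _ fun p ω => by
        simp only [kernel_mapP, MagneticSystem.kernel_add, ContinuousMap.add_apply]
      map_smul' := fun c f => MagneticSystem.alg_ext _ fun p ω => by
        simp only [kernel_mapP, MagneticSystem.kernel_smul, ContinuousMap.smul_apply,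
          RingHom.id_apply] }
    (Fintype.card (Torus d N)) (norm_mapP_le N F hF hQ)

theorem mapPL_apply (f : (perSystem N F hF).Alg) : mapPL N F hF hQ f = mapP N F hF hQ f := rfl

/-- The failure of `P` to be multiplicative comes from the steps which leave the cell. -/
theorem kernel_torHamiltonian_sub_mul_mapP (hN : 1 ≤ N) {W : ℝ} {z : ℂ}
    (hz : z ∉ perSpectrum N W F hF hQ) (p : Torus d N) (ω : OmegaTor d N) :
    (torSystem N F hF hQ).kernel ((torHamiltonian N W F hF hQ - algebraMap ℂ _ z)
          * mapP N F hF hQ (res (perHamiltonian N W F hF hQ) z) - 1) p ω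
      = ∑ i, ((perSystem N F hF).kernel (res (perHamiltonian N W F hF hQ) z)
              (coord (p - torStep N i))
              (unroll ((torSystem N F hF hQ).shift (-torStep N i) ω))
            - (perSystem N F hF).kernel (res (perHamiltonian N W F hF hQ) z) (coord p - step i)
              (unroll ((torSystem N F hF hQ).shift (-torStep N i) ω)))
          * (torSystem N F hF hQ).phase p (torStep N i) := by
  classical
  -- The identity (H - z) R = 1 in the periodic algebra, read at the representative of `p`, replaces
  -- the entry of 1 in the claim.
  have h1 := congrArg (fun a => (perSystem N F hF).kernel a (coord p) (unroll ω))
    (mul_res_cancel hz)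
  simp only [MagneticSystem.kernel_one] at h1
  change (perSystem N F hF).kernel ((perHamiltonian N W F hF hQ - algebraMap ℂ _ z)
    * res (perHamiltonian N W F hF hQ) z) (coord p) (unroll ω) = _ at h1
  have h0 : coord p = 0 ↔ p = 0 := by rw [← coord_injective.eq_iff, coord_zero]
  rw [perHamiltonian_sub N F hF hQ hN, MagneticSystem.kernel_hopKern_mul] at h1
  rw [torHamiltonian_sub N F hF hQ hN, MagneticSystem.kernel_sub, ContinuousMap.sub_apply,
    MagneticSystem.kernel_hopKern_mul, MagneticSystem.kernel_one]
  simp only [h0] at h1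
  rw [← h1, kernel_mapP]
  have hV : (torPotential d N W - ContinuousMap.const (OmegaTor d N) z) ω
      = (perPotential d N W - ContinuousMap.const (OmegaPer d N) z) (unroll ω) := by
    change (W : ℂ) * ((ω 0 : ℝ) : ℂ) - z = (W : ℂ) * ((ω (toTorus N 0) : ℝ) : ℂ) - z
    rw [toTorus_zero]
  rw [hV, add_sub_add_left_eq_sub, ← Finset.sum_sub_distrib]
  refine Finset.sum_congr rfl fun i _ => ?_
  rw [kernel_mapP, perSystem_shift_unroll N F hF hQ, toTorus_neg,
    ← torSystem_phase N F hF hQ (coord p) (step i), toTorus_coord, ← torStep, sub_mul]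

end Bridge

/-! ### The boundary error and the resolvent estimate. -/

section Comparison

variable {d : ℕ} (N : ℕ) (F : Matrix (Fin (d + 1)) (Fin (d + 1)) ℝ) (hF : F.transpose = -F)
  (hQ : ∀ i j, ∃ k : ℤ, F i j = 2 / (2 * N + 1) * k)

theorem norm_torHamiltonian_sub_mul_mapP_le (hN : 1 ≤ N) {W : ℝ} {z : ℂ}
    (hz : z ∉ perSpectrum N W F hF hQ) {ξ : ℝ} (hξ : 0 < ξ)
    (hδξ : 2 * ((d + 1 : ℕ) : ℝ) * Real.sinh ξ < Metric.infDist z (perSpectrum N W F hF hQ)) :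
    ‖(torHamiltonian N W F hF hQ - algebraMap ℂ _ z)
        * mapP N F hF hQ (res (perHamiltonian N W F hF hQ) z) - 1‖
      ≤ 4 * ((d + 1 : ℕ) : ℝ) * latticeSum d (ξ / √2) * Real.exp (-(ξ / √2) * N)
        / (Metric.infDist z (perSpectrum N W F hF hQ) - 2 * ((d + 1 : ℕ) : ℝ) * Real.sinh ξ) := by
  set δ := Metric.infDist z (perSpectrum N W F hF hQ)
  set R := res (perHamiltonian N W F hF hQ) z
  set C : ℝ := (δ - 2 * ((d + 1 : ℕ) : ℝ) * Real.sinh ξ)⁻¹ with hC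
  have hC0 : 0 ≤ C := inv_nonneg.2 (by linarith)
  have hη : 0 < ξ / √2 := by positivity
  have hR : ∀ n ω, ‖(perSystem N F hF).kernel R n ω‖ ≤ Real.exp (-ξ * latticeNorm n) * C := by
    intro n ω
    have h1 := res_mul_cancel hz
    have h2 := mul_res_cancel hz
    rw [perHamiltonian_sub N F hF hQ hN] at h1 h2
    exact norm_kernel_inverse_le (perSystem N F hF) _ R δ ξ hξ.le hδξ
      (norm_res_perHamiltonian_le N F hF hQ hN hz) h1 h2 n ω
  -- The factor 2 counts the two kernel values at a crossing, which obey the same bound.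
  set b : Fin (d + 1) × Bool → Torus (d + 1) N → ℝ := fun i p =>
    2 * C * Real.exp (-(ξ / √2) * N) * (if coord p i.1 = -(N : ℤ) * step i i.1 then
      Real.exp (-(ξ / √2) * latticeNorm (i.1.removeNth (coord p))) else 0) with hb
  have hker : ∀ p, ‖(torSystem N F hF hQ).kernel
      ((torHamiltonian N W F hF hQ - algebraMap ℂ _ z) * mapP N F hF hQ R - 1) p‖
      ≤ ∑ i, b i p := by
    intro p
    have hb0 : ∀ i, 0 ≤ b i p := fun i => by
      simp only [hb]
      split_ifs <;> positivity
    refine (ContinuousMap.norm_le _ (Finset.sum_nonneg fun i _ => hb0 i)).2 fun ω => ?_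
    rw [kernel_torHamiltonian_sub_mul_mapP N F hF hQ hN hz]
    refine (norm_sum_le _ _).trans (Finset.sum_le_sum fun i _ => ?_)
    rw [norm_mul, MagneticSystem.norm_phase, mul_one]
    by_cases h : coord p i.1 = -(N : ℤ) * step i i.1
    · have hs : |step i i.1| = 1 := by
        obtain ⟨j, b⟩ := i
        cases b <;> simp [step]
      -- The wrapped point lies on the opposite face, with crossing coordinate of size N.
      have e1 : Real.exp (-ξ * latticeNorm (coord (p - torStep N i)))
          ≤ Real.exp (-(ξ / √2) * N)
            * Real.exp (-(ξ / √2) * latticeNorm (i.1.removeNth (coord p))) := by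
        rw [coord_sub_torStep_face p i h, ← removeNth_add_step (coord p) (2 * N) i]
        refine exp_neg_latticeNorm_le hξ.le i.1 _ ?_
        have : (coord p + fun k => 2 * (N : ℤ) * step i k) i.1 = N * step i i.1 := by
          rw [Pi.add_apply, h]; ring
        rw [this, abs_mul, hs, mul_one]
        exact le_abs_self _
      -- The unwrapped point lies just outside the cell, with crossing coordinate of size N + 1.
      have e2 : Real.exp (-ξ * latticeNorm (coord p - step i))
          ≤ Real.exp (-(ξ / √2) * N)
            * Real.exp (-(ξ / √2) * latticeNorm (i.1.removeNth (coord p))) := by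
        have e : coord p - step i = coord p + fun k => (-1) * step i k := by
          funext k
          simp [sub_eq_add_neg]
        rw [e, ← removeNth_add_step (coord p) (-1) i]
        refine exp_neg_latticeNorm_le hξ.le i.1 _ ?_
        have : (coord p + fun k => (-1) * step i k) i.1 = -((N + 1 : ℤ) * step i i.1) := by
          rw [Pi.add_apply, h]; ring
        rw [this, abs_neg, abs_mul, hs, mul_one]
        exact le_trans (by omega) (le_abs_self _)
      simp only [hb, if_pos h]
      refine (norm_sub_le _ _).trans ((add_le_add (hR _ _) (hR _ _)).trans ?_)
      refine (add_le_add (mul_le_mul_of_nonneg_right e1 hC0)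
        (mul_le_mul_of_nonneg_right e2 hC0)).trans (le_of_eq ?_)
      ring
    · rw [coord_sub_torStep p i h, sub_self, norm_zero]
      exact hb0 i
  refine ((torSystem N F hF hQ).norm_le_sum_kernel _).trans
    ((Finset.sum_le_sum fun p _ => hker p).trans ?_)
  rw [Finset.sum_comm]
  have hi : ∀ i, ∑ p, b i p
      ≤ 2 * C * Real.exp (-(ξ / √2) * N) * latticeSum d (ξ / √2) := fun i => by
    simp only [hb]
    rw [← Finset.mul_sum]
    exact mul_le_mul_of_nonneg_left (sum_face_le hη i.1 _) (by positivity)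
  refine (Finset.sum_le_sum fun i _ => hi i).trans (le_of_eq ?_)
  rw [Finset.sum_const, Finset.card_univ, Fintype.card_prod, Fintype.card_fin, Fintype.card_bool,
    nsmul_eq_mul, hC, div_eq_mul_inv]
  push_cast
  ring

theorem latticeSum_nonneg (d : ℕ) (η : ℝ) : 0 ≤ latticeSum d η :=
  tsum_nonneg fun _ => Real.exp_nonneg _

theorem norm_res_sub_mapP_res_le (hN : 1 ≤ N) {W : ℝ} {z : ℂ}
    (hz : z ∉ perSpectrum N W F hF hQ) {ξ : ℝ} (hξ : 0 < ξ)
    (hδξ : 2 * ((d + 1 : ℕ) : ℝ) * Real.sinh ξ < Metric.infDist z (perSpectrum N W F hF hQ)) :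
    ‖res (torHamiltonian N W F hF hQ) z - mapP N F hF hQ (res (perHamiltonian N W F hF hQ) z)‖
      ≤ 4 * ((d + 1 : ℕ) : ℝ) ^ 2 * latticeSum d (ξ / √2) * Real.exp (-(ξ / √2) * N)
        / (Metric.infDist z (torSpectrum N W F hF hQ)
          * (Metric.infDist z (perSpectrum N W F hF hQ)
            - 2 * ((d + 1 : ℕ) : ℝ) * Real.sinh ξ)) := by
  have hz' : z ∉ spectrum ℂ (torHamiltonian N W F hF hQ) :=
    fun h => hz (torSpectrum_subset N F hF hQ hN W h)
  have := nontrivial_alg (torSystem N F hF hQ)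
  have h1 := norm_res_le (isSelfAdjoint_torHamiltonian N F hF hQ hN W) hz'
  have h2 := norm_torHamiltonian_sub_mul_mapP_le N F hF hQ hN hz hξ hδξ
  set X := mapP N F hF hQ (res (perHamiltonian N W F hF hQ) z)
  set T := torHamiltonian N W F hF hQ
  have e : res T z - X = -(res T z * ((T - algebraMap ℂ _ z) * X - 1)) := by
    rw [mul_sub, ← mul_assoc, res_mul_cancel hz', one_mul, mul_one, neg_sub]
  rw [e, norm_neg]
  refine (norm_mul_le _ _).trans ((mul_le_mul h1 h2 (norm_nonneg _)
    (inv_nonneg.2 Metric.infDist_nonneg)).trans ?_)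
  change (Metric.infDist z (torSpectrum N W F hF hQ))⁻¹ * _ ≤ _
  rw [inv_mul_eq_div, div_div, mul_comm (Metric.infDist z (torSpectrum N W F hF hQ))]
  -- The argument yields the factor 4d; it is weakened here to 4d².
  have hd : ((d + 1 : ℕ) : ℝ) ≤ ((d + 1 : ℕ) : ℝ) ^ 2 := by
    have : (1 : ℝ) ≤ ((d + 1 : ℕ) : ℝ) := by exact_mod_cast Nat.succ_pos d
    nlinarith
  have := latticeSum_nonneg d (ξ / √2)
  refine div_le_div_of_nonneg_right ?_ (mul_nonneg (by linarith) Metric.infDist_nonneg)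
  gcongr

end Comparison

/-! ### The contour around a compact set of real numbers -/

section Contour

open MeasureTheory

variable {K : Set ℂ} {κ : ℝ}

theorem dist_ofReal_of_im_eq_zero {k : ℂ} (hk : k.im = 0) (x : ℝ) :
    dist (x : ℂ) k = |x - k.re| := by
  rw [Complex.dist_eq, Complex.norm_eq_sqrt_sq_add_sq]
  simp [hk, Real.sqrt_sq_eq_abs]

/-- As `K` is real, Pythagoras gives |z - k|² = |Re z - k|² + (Im z)² for every k in `K`, so the
squared distances of z and Re z to `K` differ by (Im z)². -/
theorem infDist_eq_of_sq (hK : IsCompact K) (hne : K.Nonempty) (hre : ∀ z ∈ K, z.im = 0)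
    (hκ : 0 ≤ κ) {z : ℂ} (hz : z.im ^ 2 = κ ^ 2 - Metric.infDist (z.re : ℂ) K ^ 2) :
    Metric.infDist z K = κ := by
  have hd : ∀ k ∈ K, dist z k ^ 2 = dist (z.re : ℂ) k ^ 2 + z.im ^ 2 := fun k hk => by
    rw [dist_ofReal_of_im_eq_zero (hre k hk), sq_abs, Complex.dist_eq, Complex.sq_norm,
      Complex.normSq_apply, Complex.sub_re, Complex.sub_im, hre k hk]
    ring
  refine le_antisymm ?_ ?_
  · obtain ⟨k, hk, he⟩ := hK.exists_infDist_eq_dist hne (z.re : ℂ)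
    refine (Metric.infDist_le_dist_of_mem hk).trans (abs_le_of_sq_le_sq' ?_ hκ).2
    rw [hd k hk, hz, he]
    linarith
  · obtain ⟨k, hk, he⟩ := hK.exists_infDist_eq_dist hne z
    rw [he]
    refine (abs_le_of_sq_le_sq' ?_ dist_nonneg).2
    have h1 := Metric.infDist_le_dist_of_mem hk (x := (z.re : ℂ))
    have h2 := pow_le_pow_left₀ Metric.infDist_nonneg h1 2
    rw [hd k hk]
    linarith

theorem sq_sqrt_of_mem_contourBase {x : ℝ} (hx : x ∈ contourBase K κ) :
    √(κ ^ 2 - Metric.infDist (x : ℂ) K ^ 2) ^ 2 = κ ^ 2 - Metric.infDist (x : ℂ) K ^ 2 := by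
  have h : Metric.infDist (x : ℂ) K < κ := hx
  have h0 : 0 ≤ Metric.infDist (x : ℂ) K := Metric.infDist_nonneg
  exact Real.sq_sqrt (by nlinarith)

theorem sqrt_pos_of_mem_contourBase {x : ℝ} (hx : x ∈ contourBase K κ) :
    0 < √(κ ^ 2 - Metric.infDist (x : ℂ) K ^ 2) := by
  have h : Metric.infDist (x : ℂ) K < κ := hx
  have h0 : 0 ≤ Metric.infDist (x : ℂ) K := Metric.infDist_nonneg
  exact Real.sqrt_pos.2 (by nlinarith)

theorem infDist_contourLower (hK : IsCompact K) (hne : K.Nonempty) (hre : ∀ z ∈ K, z.im = 0)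
    (hκ : 0 ≤ κ) {x : ℝ} (hx : x ∈ contourBase K κ) :
    Metric.infDist (contourLower K κ x) K = κ := by
  refine infDist_eq_of_sq hK hne hre hκ ?_
  simp [contourLower, sq_sqrt_of_mem_contourBase hx]

theorem infDist_contourUpper (hK : IsCompact K) (hne : K.Nonempty) (hre : ∀ z ∈ K, z.im = 0)
    (hκ : 0 ≤ κ) {x : ℝ} (hx : x ∈ contourBase K κ) :
    Metric.infDist (contourUpper K κ x) K = κ := by
  refine infDist_eq_of_sq hK hne hre hκ ?_
  simp [contourUpper, sq_sqrt_of_mem_contourBase hx]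

theorem continuous_infDist_ofReal : Continuous fun x : ℝ => Metric.infDist (x : ℂ) K :=
  (Metric.continuous_infDist_pt K).comp Complex.continuous_ofReal

theorem isOpen_contourBase : IsOpen (contourBase K κ) :=
  isOpen_lt continuous_infDist_ofReal continuous_const

theorem continuous_contourLower : Continuous (contourLower K κ) := by
  have := continuous_infDist_ofReal (K := K)
  unfold contourLower
  fun_prop

theorem continuous_contourUpper : Continuous (contourUpper K κ) := by
  have := continuous_infDist_ofReal (K := K)
  unfold contourUpper
  fun_prop

/-- The speed of the parametrization of the contour by the real part is at most this. -/
noncomputable def speedBound (K : Set ℂ) (κ x : ℝ) : ℝ :=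
  1 + 2 * κ / √(κ ^ 2 - Metric.infDist (x : ℂ) K ^ 2)

/-- Factor the difference of the squares of the two heights: the distance to `K` is 1-Lipschitz and
below κ, and the sum of the heights is at least the height over `x`. -/
theorem abs_sqrt_sub_sqrt_le {x y : ℝ} (hx : x ∈ contourBase K κ) (hy : y ∈ contourBase K κ) :
    |√(κ ^ 2 - Metric.infDist (y : ℂ) K ^ 2) - √(κ ^ 2 - Metric.infDist (x : ℂ) K ^ 2)|
      ≤ 2 * κ / √(κ ^ 2 - Metric.infDist (x : ℂ) K ^ 2) * |y - x| := by
  have hsx := sq_sqrt_of_mem_contourBase hx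
  have hsy := sq_sqrt_of_mem_contourBase hy
  have hpx := sqrt_pos_of_mem_contourBase hx
  have hpy := sqrt_pos_of_mem_contourBase hy
  have hl : |Metric.infDist (y : ℂ) K - Metric.infDist (x : ℂ) K| ≤ |y - x| := by
    have h := (Metric.lipschitz_infDist_pt K).dist_le_mul (y : ℂ) (x : ℂ)
    rw [NNReal.coe_one, one_mul, Real.dist_eq, Complex.dist_eq, ← Complex.ofReal_sub,
      Complex.norm_real, Real.norm_eq_abs] at h
    exact h
  have hx1 : Metric.infDist (x : ℂ) K < κ := hx
  have hy1 : Metric.infDist (y : ℂ) K < κ := hy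
  have hx0 : 0 ≤ Metric.infDist (x : ℂ) K := Metric.infDist_nonneg
  have hy0 : 0 ≤ Metric.infDist (y : ℂ) K := Metric.infDist_nonneg
  set s := √(κ ^ 2 - Metric.infDist (x : ℂ) K ^ 2)
  set t := √(κ ^ 2 - Metric.infDist (y : ℂ) K ^ 2)
  set a := Metric.infDist (x : ℂ) K
  set b := Metric.infDist (y : ℂ) K
  have h1 : |t - s| * (t + s) = |b - a| * (b + a) := by
    rw [← abs_of_pos (add_pos hpy hpx), ← abs_of_nonneg (add_nonneg hy0 hx0), ← abs_mul, ← abs_mul,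
      ← abs_neg ((b - a) * (b + a))]
    congr 1
    linear_combination hsy - hsx
  rw [div_mul_eq_mul_div, le_div_iff₀ hpx]
  calc |t - s| * s ≤ |t - s| * (t + s) := by gcongr; linarith
    _ = |b - a| * (b + a) := h1
    _ ≤ |y - x| * (2 * κ) := mul_le_mul hl (by linarith) (by linarith) (abs_nonneg _)
    _ = _ := mul_comm _ _

theorem speedBound_nonneg {x : ℝ} (hx : x ∈ contourBase K κ) : 0 ≤ speedBound K κ x := by
  have hx1 : Metric.infDist (x : ℂ) K < κ := hx
  have hx0 : 0 ≤ Metric.infDist (x : ℂ) K := Metric.infDist_nonneg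
  have := sqrt_pos_of_mem_contourBase hx
  have : 0 < κ := by linarith
  unfold speedBound
  positivity

theorem norm_deriv_contour_le {f : ℝ → ℂ} (c : ℂ) (hc : ‖c‖ = 1)
    (hf : ∀ x, f x = x + c * (√(κ ^ 2 - Metric.infDist (x : ℂ) K ^ 2) : ℝ))
    {x : ℝ} (hx : x ∈ contourBase K κ) : ‖deriv f x‖ ≤ speedBound K κ x := by
  -- A local Lipschitz estimate at `x` suffices. Differentiability can fail where the distance to
  -- `K` has a kink, and there `deriv` is 0.
  refine norm_deriv_le_of_lip' (speedBound_nonneg hx) ?_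
  filter_upwards [isOpen_contourBase.mem_nhds hx] with y hy
  have e : f y - f x = ((y - x : ℝ) : ℂ)
      + c * ((√(κ ^ 2 - Metric.infDist (y : ℂ) K ^ 2)
        - √(κ ^ 2 - Metric.infDist (x : ℂ) K ^ 2) : ℝ) : ℂ) := by
    rw [hf, hf]
    push_cast
    ring
  rw [e]
  refine (norm_add_le _ _).trans ?_
  rw [norm_mul, hc, one_mul, Complex.norm_real, Complex.norm_real, Real.norm_eq_abs,
    Real.norm_eq_abs, speedBound, add_mul, one_mul]
  exact add_le_add le_rfl (abs_sqrt_sub_sqrt_le hx hy)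

theorem norm_deriv_contourLower_le {x : ℝ} (hx : x ∈ contourBase K κ) :
    ‖deriv (contourLower K κ) x‖ ≤ speedBound K κ x :=
  norm_deriv_contour_le (-Complex.I) (by simp) (fun x => by rw [contourLower]; ring) hx

theorem norm_deriv_contourUpper_le {x : ℝ} (hx : x ∈ contourBase K κ) :
    ‖deriv (contourUpper K κ) x‖ ≤ speedBound K κ x :=
  norm_deriv_contour_le Complex.I (by simp) (fun x => by rw [contourUpper]) hx

/-- The integrand is the nonnegative derivative of arcsin((x - k)/κ), which is continuous up to the
end points. -/
theorem integrableOn_inv_sqrt_sq_sub_sq (hκ : 0 < κ) (k : ℝ) :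
    IntegrableOn (fun x : ℝ => (√(κ ^ 2 - (x - k) ^ 2))⁻¹) (Set.Ioo (k - κ) (k + κ)) := by
  have h : IntegrableOn (fun x : ℝ => (√(κ ^ 2 - (x - k) ^ 2))⁻¹)
      (Set.Ioc (k - κ) (k + κ)) := by
    refine intervalIntegral.integrableOn_deriv_of_nonneg
      (g := fun x => Real.arcsin ((x - k) / κ)) (Continuous.continuousOn (by fun_prop))
      (fun x hx => ?_) fun x _ => by positivity
    have h1 : (x - k) / κ ≠ -1 := by
      rw [Ne, div_eq_iff hκ.ne']; linarith [hx.1]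
    have h2 : (x - k) / κ ≠ 1 := by
      rw [Ne, div_eq_iff hκ.ne']; linarith [hx.2]
    have h3 := (Real.hasDerivAt_arcsin h1 h2).comp x
      (((hasDerivAt_id x).sub_const k).div_const κ)
    refine h3.congr_deriv ?_
    have e : κ ^ 2 - (x - k) ^ 2 = κ ^ 2 * (1 - ((x - k) / κ) ^ 2) := by
      field_simp
    rw [e, Real.sqrt_mul (sq_nonneg κ), Real.sqrt_sq hκ.le]
    rw [mul_inv, one_div, one_div, mul_comm]
  exact h.mono_set Set.Ioo_subset_Ioc_self

/-- Near `k` the distance to `K` is at most |x - k|, so the contour is no steeper in this bound than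
the circle of radius κ about `k`. -/
theorem integrableOn_speedBound_ball (hκ : 0 < κ) {k : ℂ} (hk : k ∈ K) (hk0 : k.im = 0) :
    IntegrableOn (speedBound K κ) {x : ℝ | dist (x : ℂ) k < κ} := by
  have hset : {x : ℝ | dist (x : ℂ) k < κ} = Set.Ioo (k.re - κ) (k.re + κ) := by
    ext x
    rw [Set.mem_ofPred_eq, dist_ofReal_of_im_eq_zero hk0, abs_lt, Set.mem_Ioo]
    constructor <;> rintro ⟨h1, h2⟩ <;> constructor <;> linarith
  have hmeas : Measurable (speedBound K κ) := by
    have := (continuous_infDist_ofReal (K := K)).measurable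
    unfold speedBound
    fun_prop
  have hint : IntegrableOn (fun x : ℝ => 1 + 2 * κ * (√(κ ^ 2 - (x - k.re) ^ 2))⁻¹)
      (Set.Ioo (k.re - κ) (k.re + κ)) :=
    (integrableOn_const (by simp)).add
      ((integrableOn_inv_sqrt_sq_sub_sq hκ k.re).const_mul _)
  rw [hset]
  refine hint.mono' hmeas.aestronglyMeasurable ?_
  filter_upwards [ae_restrict_mem measurableSet_Ioo] with x hx
  rw [← hset, Set.mem_ofPred_eq] at hx
  have hle := Metric.infDist_le_dist_of_mem hk (x := (x : ℂ))
  rw [Real.norm_of_nonneg (speedBound_nonneg (lt_of_le_of_lt hle hx)), speedBound, div_eq_mul_inv]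
  have h0 : 0 ≤ Metric.infDist (x : ℂ) K := Metric.infDist_nonneg
  have hd : dist (x : ℂ) k ^ 2 = (x - k.re) ^ 2 := by
    rw [dist_ofReal_of_im_eq_zero hk0, sq_abs]
  have hpos : 0 < κ ^ 2 - (x - k.re) ^ 2 := by
    rw [← hd]
    have : 0 ≤ dist (x : ℂ) k := dist_nonneg
    nlinarith
  have h1 : κ ^ 2 - (x - k.re) ^ 2 ≤ κ ^ 2 - Metric.infDist (x : ℂ) K ^ 2 := by
    rw [← hd]
    have := pow_le_pow_left₀ h0 hle 2
    linarith
  have h2 := inv_anti₀ (Real.sqrt_pos.2 hpos) (Real.sqrt_le_sqrt h1)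
  have := mul_le_mul_of_nonneg_left h2 (show 0 ≤ 2 * κ by linarith)
  linarith

/-- The base of the contour is a finite union of intervals of radius `κ` around points of `K`, and
so the contour has finite length. -/
theorem integrableOn_speedBound (hK : IsCompact K) (hne : K.Nonempty) (hre : ∀ z ∈ K, z.im = 0)
    (hκ : 0 < κ) : IntegrableOn (speedBound K κ) (contourBase K κ) := by
  have hb : contourBase K κ = {x : ℝ | ∃ k ∈ K, dist (x : ℂ) k < κ} := by
    ext x
    exact Metric.infDist_lt_iff hne
  rw [hb]
  refine hK.induction_on
    (p := fun S => IntegrableOn (speedBound K κ) {x : ℝ | ∃ k ∈ S, dist (x : ℂ) k < κ})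
    ?_ ?_ ?_ ?_
  · simp
  · intro s t hst ht
    exact ht.mono_set fun x ⟨k, hk, hx⟩ => ⟨k, hst hk, hx⟩
  · intro s t hs ht
    refine (hs.union ht).mono_set ?_
    rintro x ⟨k, hk | hk, hx⟩
    · exact Or.inl ⟨k, hk, hx⟩
    · exact Or.inr ⟨k, hk, hx⟩
  · intro c hc
    -- With radius κ/2 this piece of `K` has diameter at most κ, so the intervals about its leftmost
    -- and rightmost points already cover those about all its points.
    refine ⟨K ∩ Metric.closedBall c (κ / 2), inter_mem_nhdsWithin _
      (Metric.closedBall_mem_nhds c (by linarith)), ?_⟩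
    have hcomp : IsCompact (K ∩ Metric.closedBall c (κ / 2)) :=
      hK.inter_right Metric.isClosed_closedBall
    have hne' : (K ∩ Metric.closedBall c (κ / 2)).Nonempty :=
      ⟨c, hc, Metric.mem_closedBall_self (by linarith)⟩
    obtain ⟨l, hl, hl'⟩ := hcomp.exists_isMinOn hne' Complex.continuous_re.continuousOn
    obtain ⟨u, hu, hu'⟩ := hcomp.exists_isMaxOn hne' Complex.continuous_re.continuousOn
    refine ((integrableOn_speedBound_ball hκ hl.1 (hre l hl.1)).union
      (integrableOn_speedBound_ball hκ hu.1 (hre u hu.1))).mono_set ?_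
    rintro x ⟨k, hk, hx⟩
    have h1 : l.re ≤ k.re := hl' hk
    have h2 : k.re ≤ u.re := hu' hk
    have h3 : u.re - l.re ≤ κ := by
      have h4 := (Complex.abs_re_le_norm (u - l)).trans
        (le_of_eq (dist_eq_norm u l).symm)
      have h5 := dist_triangle_right u l c
      have h6 := Metric.mem_closedBall.1 hu.2
      have h7 := Metric.mem_closedBall.1 hl.2
      have h8 := le_abs_self (u - l).re
      rw [Complex.sub_re] at h4 h8
      linarith
    rw [Set.mem_union, Set.mem_ofPred_eq, Set.mem_ofPred_eq,
      dist_ofReal_of_im_eq_zero (hre l hl.1), dist_ofReal_of_im_eq_zero (hre u hu.1), abs_lt,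
      abs_lt]
    rw [dist_ofReal_of_im_eq_zero (hre k hk.1), abs_lt] at hx
    by_cases h : x < u.re
    · left; constructor <;> linarith
    · right; constructor <;> linarith

/-! ### Integration along the contour. -/

variable {E : Type} [NormedAddCommGroup E] [NormedSpace ℂ E]

theorem isCompact_setOf_infDist_eq (hK : IsCompact K) (hne : K.Nonempty) :
    IsCompact {z : ℂ | Metric.infDist z K = κ} := by
  refine (hK.cthickening (r := κ)).of_isClosed_subset
    (isClosed_eq (Metric.continuous_infDist_pt K) continuous_const) fun z hz => ?_
  obtain ⟨k, hk, he⟩ := hK.exists_infDist_eq_dist hne z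
  exact Metric.mem_cthickening_of_dist_le z k κ K hk (he.symm.trans hz).le

theorem integrableOn_deriv_smul (hK : IsCompact K) (hne : K.Nonempty) (hre : ∀ z ∈ K, z.im = 0)
    (hκ : 0 < κ) {g : ℂ → E} (hg : ContinuousOn g {z | Metric.infDist z K = κ}) {f : ℝ → ℂ}
    (hf : Continuous f) (hfK : ∀ x ∈ contourBase K κ, Metric.infDist (f x) K = κ)
    (hf' : ∀ x ∈ contourBase K κ, ‖deriv f x‖ ≤ speedBound K κ x) :
    IntegrableOn (fun x => deriv f x • g (f x)) (contourBase K κ) := by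
  obtain ⟨M, hM⟩ := (isCompact_setOf_infDist_eq hK hne (κ := κ)).exists_bound_of_continuousOn hg
  have hm := (isOpen_contourBase (K := K) (κ := κ)).measurableSet
  refine ((integrableOn_speedBound hK hne hre hκ).mul_const M).mono'
    ((aestronglyMeasurable_deriv f _).smul
      ((hg.comp hf.continuousOn hfK).aestronglyMeasurable hm)) ?_
  filter_upwards [ae_restrict_mem hm] with x hx
  rw [norm_smul]
  exact mul_le_mul (hf' x hx) (hM _ (hfK x hx)) (norm_nonneg _) (speedBound_nonneg hx)

theorem contourIntegrable_of_continuousOn (hK : IsCompact K) (hne : K.Nonempty)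
    (hre : ∀ z ∈ K, z.im = 0) (hκ : 0 < κ) {g : ℂ → E}
    (hg : ContinuousOn g {z | Metric.infDist z K = κ}) : ContourIntegrable K κ g :=
  ⟨integrableOn_deriv_smul hK hne hre hκ hg continuous_contourLower
      (fun _ hx => infDist_contourLower hK hne hre hκ.le hx)
      fun _ hx => norm_deriv_contourLower_le hx,
    integrableOn_deriv_smul hK hne hre hκ hg continuous_contourUpper
      (fun _ hx => infDist_contourUpper hK hne hre hκ.le hx)
      fun _ hx => norm_deriv_contourUpper_le hx⟩

theorem contourIntegral_sub {g g' : ℂ → E} (hg : ContourIntegrable K κ g)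
    (hg' : ContourIntegrable K κ g') :
    contourIntegral K κ (fun z => g z - g' z)
      = contourIntegral K κ g - contourIntegral K κ g' := by
  simp only [contourIntegral, smul_sub]
  rw [integral_sub hg.1 hg'.1, integral_sub hg.2 hg'.2]
  abel

theorem map_contourIntegral [CompleteSpace E] {E' : Type} [NormedAddCommGroup E']
    [NormedSpace ℂ E'] [CompleteSpace E'] (L : E →L[ℂ] E') {g : ℂ → E}
    (hg : ContourIntegrable K κ g) :
    L (contourIntegral K κ g) = contourIntegral K κ fun z => L (g z) := by
  rw [contourIntegral, map_sub, ← L.integral_comp_comm hg.1, ← L.integral_comp_comm hg.2]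
  simp only [map_smul]
  rfl

theorem norm_contourIntegral_le (hK : IsCompact K) (hne : K.Nonempty)
    (hre : ∀ z ∈ K, z.im = 0) (hκ : 0 < κ) {Φ : ℂ → ℂ} (hΦ : ContourIntegrable K κ Φ)
    {g : ℂ → E} {C : ℝ} (hC : ∀ z, Metric.infDist z K = κ → ‖g z‖ ≤ ‖Φ z‖ * C) :
    ‖contourIntegral K κ g‖ ≤ 2 * Real.pi * contourMean K κ Φ * C := by
  have hm := (isOpen_contourBase (K := K) (κ := κ)).measurableSet
  have key : ∀ f : ℝ → ℂ, (∀ x ∈ contourBase K κ, Metric.infDist (f x) K = κ) →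
      IntegrableOn (fun x => deriv f x • Φ (f x)) (contourBase K κ) →
      ‖∫ x in contourBase K κ, deriv f x • g (f x)‖
        ≤ (∫ x in contourBase K κ, ‖Φ (f x)‖ * ‖deriv f x‖) * C := by
    intro f hfK hint
    have hint' : IntegrableOn (fun x => ‖Φ (f x)‖ * ‖deriv f x‖ * C) (contourBase K κ) := by
      refine (hint.norm.mul_const C).congr (Filter.Eventually.of_forall fun x => ?_)
      simp only [norm_smul, mul_comm ‖deriv f x‖]
    rw [← integral_mul_const]
    refine norm_integral_le_of_norm_le hint' ?_
    filter_upwards [ae_restrict_mem hm] with x hx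
    rw [norm_smul]
    have := mul_le_mul_of_nonneg_left (hC _ (hfK x hx)) (norm_nonneg (deriv f x))
    linarith
  have h1 := key _ (fun x hx => infDist_contourLower hK hne hre hκ.le hx) hΦ.1
  have h2 := key _ (fun x hx => infDist_contourUpper hK hne hre hκ.le hx) hΦ.2
  rw [contourMean, ← mul_assoc, mul_one_div_cancel (by positivity), one_mul, add_mul]
  exact (norm_sub_le _ _).trans (add_le_add h1 h2)

theorem continuousOn_res {A : Type} [NormedRing A] [NormedAlgebra ℂ A] [CompleteSpace A] {a : A}
    {s : Set ℂ} (hs : ∀ z ∈ s, z ∉ spectrum ℂ a) : ContinuousOn (res a) s := by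
  intro z hz
  obtain ⟨u, hu⟩ := isUnit_sub_algebraMap (hs z hz)
  have h1 : ContinuousAt Ring.inverse (a - algebraMap ℂ A z) := by
    rw [← hu]
    exact NormedRing.inverse_continuousAt u
  have h2 : ContinuousAt (fun z : ℂ => a - algebraMap ℂ A z) z :=
    (continuous_const.sub (continuous_algebraMap ℂ A)).continuousAt
  exact (ContinuousAt.comp (f := fun z : ℂ => a - algebraMap ℂ A z) h1 h2).continuousWithinAt

end Contour

/-! ### The comparison of the functional calculi. -/

section FunctionalCalculus

variable {d : ℕ} (N : ℕ) (F : Matrix (Fin d) (Fin d) ℝ) (hF : F.transpose = -F)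
  (hQ : ∀ i j, ∃ k : ℤ, F i j = 2 / (2 * N + 1) * k)

theorem im_eq_zero_of_mem_perSpectrum (hN : 1 ≤ N) (W : ℝ) :
    ∀ z ∈ perSpectrum N W F hF hQ, z.im = 0 := fun z hz => by
  rw [(isSelfAdjoint_perHamiltonian N F hF hQ hN W).mem_spectrum_eq_re hz, Complex.ofReal_im]

theorem notMem_perSpectrum_of_infDist_eq {W κ : ℝ} (hκ : 0 < κ) {z : ℂ}
    (hz : Metric.infDist z (perSpectrum N W F hF hQ) = κ) : z ∉ perSpectrum N W F hF hQ :=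
  fun h => by
    rw [Metric.infDist_zero_of_mem h] at hz
    exact hκ.ne hz

/-- The contour avoids the periodic spectrum, hence also the torus spectrum inside it, so all three
integrands are continuous there. -/
theorem contourIntegrable_calculus (hN : 1 ≤ N) (W κ : ℝ) (Φ : ℂ → ℂ) (hκ : 0 < κ)
    (hΦ : AnalyticOnNhd ℂ Φ {z | Metric.infDist z (perSpectrum N W F hF hQ) ≤ κ}) :
    ContourIntegrable (perSpectrum N W F hF hQ) κ Φ ∧
      ContourIntegrable (perSpectrum N W F hF hQ) κ
        (fun z => Φ z • res (torHamiltonian N W F hF hQ) z) ∧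
      ContourIntegrable (perSpectrum N W F hF hQ) κ
        (fun z => Φ z • res (perHamiltonian N W F hF hQ) z) := by
  have hK := isCompact_perSpectrum N F hF hQ W
  have hne := perSpectrum_nonempty N F hF hQ W
  have hre := im_eq_zero_of_mem_perSpectrum N F hF hQ hN W
  have hc : ContinuousOn Φ {z | Metric.infDist z (perSpectrum N W F hF hQ) = κ} :=
    hΦ.continuousOn.mono fun z hz => le_of_eq hz
  have hz : ∀ z ∈ {z | Metric.infDist z (perSpectrum N W F hF hQ) = κ},
      z ∉ perSpectrum N W F hF hQ := fun z hz =>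
    notMem_perSpectrum_of_infDist_eq N F hF hQ hκ hz
  exact ⟨contourIntegrable_of_continuousOn hK hne hre hκ hc,
    contourIntegrable_of_continuousOn hK hne hre hκ (hc.smul (continuousOn_res fun z h h' =>
      hz z h (torSpectrum_subset N F hF hQ hN W h'))),
    contourIntegrable_of_continuousOn hK hne hre hκ (hc.smul (continuousOn_res hz))⟩

theorem two_mul_sinh_lt_of_lt_arsinh (hd : 1 ≤ d) {ξ δ : ℝ}
    (h : ξ < Real.arsinh (δ / (2 * d))) : 2 * d * Real.sinh ξ < δ := by
  have hd' : (0 : ℝ) < 2 * d := by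
    have : (0 : ℝ) < d := by exact_mod_cast hd
    linarith
  have h1 := Real.sinh_lt_sinh.2 h
  rwa [Real.sinh_arsinh, lt_div_iff₀' hd'] at h1

end FunctionalCalculus

section Comparison

variable {d : ℕ} (N : ℕ) (F : Matrix (Fin (d + 1)) (Fin (d + 1)) ℝ) (hF : F.transpose = -F)
  (hQ : ∀ i j, ∃ k : ℤ, F i j = 2 / (2 * N + 1) * k)

theorem norm_analyticCalc_sub_le (hN : 1 ≤ N) (W κ : ℝ) (Φ : ℂ → ℂ) (hκ : 0 < κ)
    (hΦ : AnalyticOnNhd ℂ Φ {z | Metric.infDist z (perSpectrum N W F hF hQ) ≤ κ})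
    {ξ : ℝ} (hξ : 0 < ξ) (hκξ : 2 * ((d + 1 : ℕ) : ℝ) * Real.sinh ξ < κ) :
    ‖analyticCalc (perSpectrum N W F hF hQ) κ Φ (torHamiltonian N W F hF hQ)
        - mapP N F hF hQ
          (analyticCalc (perSpectrum N W F hF hQ) κ Φ (perHamiltonian N W F hF hQ))‖
      ≤ 4 * ((d + 1 : ℕ) : ℝ) ^ 2 * latticeSum d (ξ / √2)
          * contourMean (perSpectrum N W F hF hQ) κ Φ * Real.exp (-(ξ / √2) * N)
        / (κ * (κ - 2 * ((d + 1 : ℕ) : ℝ) * Real.sinh ξ)) := by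
  obtain ⟨h1, h2, h3⟩ := contourIntegrable_calculus N F hF hQ hN W κ Φ hκ hΦ
  have hK := isCompact_perSpectrum N F hF hQ W
  have hne := perSpectrum_nonempty N F hF hQ W
  have hre := im_eq_zero_of_mem_perSpectrum N F hF hQ hN W
  set K := perSpectrum N W F hF hQ
  set C : ℝ := 4 * ((d + 1 : ℕ) : ℝ) ^ 2 * latticeSum d (ξ / √2) * Real.exp (-(ξ / √2) * N)
    / (κ * (κ - 2 * ((d + 1 : ℕ) : ℝ) * Real.sinh ξ)) with hC
  have h4 : ContourIntegrable K κ
      fun z => mapPL N F hF hQ (Φ z • res (perHamiltonian N W F hF hQ) z) := by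
    refine ⟨?_, ?_⟩
    · simpa only [map_smul, MeasureTheory.IntegrableOn] using (mapPL N F hF hQ).integrable_comp h3.1
    · simpa only [map_smul, MeasureTheory.IntegrableOn] using (mapPL N F hF hQ).integrable_comp h3.2
  rw [← mapPL_apply]
  simp only [analyticCalc]
  rw [map_smul, ← smul_sub, map_contourIntegral _ h3, ← contourIntegral_sub h2 h4, norm_smul]
  have hb : ∀ z, Metric.infDist z K = κ → ‖Φ z • res (torHamiltonian N W F hF hQ) z
      - mapPL N F hF hQ (Φ z • res (perHamiltonian N W F hF hQ) z)‖ ≤ ‖Φ z‖ * C := by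
    intro z hz
    have hz' := notMem_perSpectrum_of_infDist_eq N F hF hQ hκ hz
    rw [map_smul, ← smul_sub, norm_smul, mapPL_apply]
    refine mul_le_mul_of_nonneg_left ?_ (norm_nonneg _)
    refine (norm_res_sub_mapP_res_le N F hF hQ hN hz' hξ (by rwa [hz])).trans ?_
    -- A smaller spectrum is farther away; this makes the resolvent bound uniform along the contour.
    have h5 : κ ≤ Metric.infDist z (torSpectrum N W F hF hQ) := by
      rw [← hz]
      exact Metric.infDist_le_infDist_of_subset (torSpectrum_subset N F hF hQ hN W)
        (torSpectrum_nonempty N F hF hQ W)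
    have h6 := latticeSum_nonneg d (ξ / √2)
    have h7 : 0 < κ - 2 * ((d + 1 : ℕ) : ℝ) * Real.sinh ξ := by linarith
    rw [hz, hC]
    gcongr
  have h8 := norm_contourIntegral_le hK hne hre hκ h1 hb
  have h9 : ‖Complex.I / (2 * (Real.pi : ℂ))‖ = (2 * Real.pi)⁻¹ := by
    rw [norm_div, Complex.norm_I, norm_mul, Complex.norm_real, Real.norm_of_nonneg Real.pi_nonneg]
    simp
  rw [h9]
  refine (mul_le_mul_of_nonneg_left h8 (by positivity)).trans (le_of_eq ?_)
  rw [hC]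
  field_simp

end Comparison

end NCTorus

open NCTorus
theorem mainTheorem6 (d N : ℕ) (hd : 1 ≤ d) (hN : 1 ≤ N) (W : ℝ)
    (F : Matrix (Fin d) (Fin d) ℝ) (hF : F.transpose = -F)
    (hQ : ∀ i j, ∃ k : ℤ, F i j = 2 / (2 * N + 1) * k) :
    -- the comparison of the resolvents
    (∀ z : ℂ, z ∉ perSpectrum N W F hF hQ → z ∉ torSpectrum N W F hF hQ ∧
      ∀ ξ : ℝ, 0 < ξ →
        ξ < Real.arsinh (Metric.infDist z (perSpectrum N W F hF hQ) / (2 * d)) →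
        ‖res (torHamiltonian N W F hF hQ) z
            - mapP N F hF hQ (res (perHamiltonian N W F hF hQ) z)‖ ≤
          4 * d ^ 2 * latticeSum (d - 1) (ξ / √2) * Real.exp (-(ξ / √2) * N) /
            (Metric.infDist z (torSpectrum N W F hF hQ) *
              (Metric.infDist z (perSpectrum N W F hF hQ) - 2 * d * Real.sinh ξ))) ∧
    -- the comparison of the analytic functional calculi
    (∀ (κ : ℝ) (Φ : ℂ → ℂ), 0 < κ →
      AnalyticOnNhd ℂ Φ {z | Metric.infDist z (perSpectrum N W F hF hQ) ≤ κ} →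
      ContourIntegrable (perSpectrum N W F hF hQ) κ Φ ∧
      ContourIntegrable (perSpectrum N W F hF hQ) κ
        (fun z => Φ z • res (torHamiltonian N W F hF hQ) z) ∧
      ContourIntegrable (perSpectrum N W F hF hQ) κ
        (fun z => Φ z • res (perHamiltonian N W F hF hQ) z) ∧
      ∀ ξ : ℝ, 0 < ξ → ξ < Real.arsinh (κ / (2 * d)) →
        ‖analyticCalc (perSpectrum N W F hF hQ) κ Φ (torHamiltonian N W F hF hQ)
            - mapP N F hF hQ
              (analyticCalc (perSpectrum N W F hF hQ) κ Φ (perHamiltonian N W F hF hQ))‖ ≤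
          4 * d ^ 2 * latticeSum (d - 1) (ξ / √2) *
              contourMean (perSpectrum N W F hF hQ) κ Φ * Real.exp (-(ξ / √2) * N) /
            (κ * (κ - 2 * d * Real.sinh ξ))) := by
  -- Writing the dimension as a successor makes the faces copies of ℤ^(d-1) without truncated
  -- subtraction.
  obtain ⟨d, rfl⟩ : ∃ e, d = e + 1 := ⟨d - 1, by omega⟩
  refine ⟨fun z hz => ⟨fun h => hz (torSpectrum_subset N F hF hQ hN W h), fun ξ hξ h => ?_⟩,
    fun κ Φ hκ hΦ => ?_⟩
  · exact norm_res_sub_mapP_res_le N F hF hQ hN hz hξ (two_mul_sinh_lt_of_lt_arsinh hd h)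
  · obtain ⟨h1, h2, h3⟩ := contourIntegrable_calculus N F hF hQ hN W κ Φ hκ hΦ
    exact ⟨h1, h2, h3, fun ξ hξ h => norm_analyticCalc_sub_le N F hF hQ hN W κ Φ hκ hΦ hξ
      (two_mul_sinh_lt_of_lt_arsinh hd h)⟩
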